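/- Work in the category of compactly generated spaces, with its products; $I=[0,1]$. Let $\mathcal T$ be a small category enriched in pointed spaces (with respect to the smash product), i.e. each $\mathcal T(A,B)$ is a pointed space with basepoint $0$, and composition $(a,x)\mapsto ax$ is continuous with $a0=0$ and $0x=0$. Assume that $\mathcal T$ is a \emph{weakly bilinear mapping theory}: it has finite (enriched) products; each $\mathcal T(A,B)$ is a topological monoid, written additively (not necessarily commutative), with neutral element $0$; $(x+x')y=xy+x'y$; and for all objects $A,B,Z$ the map $(i_A^*,i_B^*)\colon \mathcal T(A\times B,Z)\to\mathcal T(A,Z)\times\mathcal T(B,Z)$, where $i_A=(1_A,0)$ and $i_B=(0,1_B)$, is a trivial fibration (a Serre fibration and a weak homotopy equivalence). Assume moreover that every mapping space $\mathcal T(A,B)$ is Serre cofibrant. An \emph{$n$-distributor} for $\mathcal T$ consists of collections $\varphi^0,\dots,\varphi^n$, where $\varphi^m$ consists of $m$-cubes $\varphi_a^{x_0,\dots,x_m}\colon I^m\to\mathcal T(X,B)$ for all $a\in\mathcal T(A,B)$ and $x_0,\dots,x_m\in\mathcal T(X,A)$, depending continuously on $(a,x_0,\dots,x_m)$, such that $\varphi_a^{x}=ax$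 for $m=0$ and, for $1\le j\le m\le n$, \[ \varphi_a^{x_0,\dots,x_m}(t_1,\dots,t_m)=\begin{cases}\varphi_a^{x_0,\dots,x_{j-1}+x_j,\dots,x_m}(t_1,\dots,\widehat{t_j},\dots,t_m)&\text{if }t_j=0,\\ \varphi_a^{x_0,\dots,x_{j-1}}(t_1,\dots,t_{j-1})+\varphi_a^{x_j,\dots,x_m}(t_{j+1},\dots,t_m)&\text{if }t_j=1.\end{cases} \] It is denoted by its top collection $\varphi^n$, which determines the others, and it is \emph{based on} the $(n-1)$-distributor $\varphi^{n-1}$ given by $\varphi^0,\dots,\varphi^{n-1}$. It is \emph{good} if (1) $\varphi_a^{x_0,\dots,x_n}(t)=\varphi_a^{p_0,\dots,p_n}(t)\,(x_0,\dots,x_n)$ for all $a,x_0,\dots,x_n,t$, where $p_i\colon A^{n+1}\to A$ are the projections, and (2) for all $a\colon A\to B$, $x\colon X\to A$ and $0\le k\le n$, the cube $\varphi_a^{0,\dots,x,\dots,0}$ (with $x$ in position $k$) is constant at $ax$. Let $n\ge1$ and let $\varphi^{n-1}$ be a good $(n-1)$-distributor for $\mathcal T$. Then there exists a good $n$-distributor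 $\varphi^n$ for $\mathcal T$ based on $\varphi^{n-1}$. Moreover, such a $\varphi^n$ is unique up to homotopy rel $\partial I^n$: for any two good $n$-distributors $\varphi^n,\psi^n$ based on $\varphi^{n-1}$ there are $n$-cubes $H_{s,a}^{x_0,\dots,x_n}\colon I^n\to\mathcal T(X,B)$ for $s\in[0,1]$, depending continuously on $(s,a,x_0,\dots,x_n)$, with $H_0=\varphi^n$, $H_1=\psi^n$ and $H_{s}|_{\partial I^n}=\varphi^n|_{\partial I^n}$ for all $s$, such that each $H_s$ is itself a good $n$-distributor based on $\varphi^{n-1}$. -/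

import Mathlib

open CategoryTheory Limits

universe v u

namespace HigherDist

/-! ### The convenient category of spaces

The convenient category is that of compactly generated spaces: spaces whose topology is coinduced
by the continuous maps out of compact Hausdorff spaces.  Its products are the `k`-ifications of the
usual products, so a function out of a product is a map of the convenient category if and only if it
is `KContinuous` for the usual product topology. -/

/-- The compact Hausdorff spaces, as a family of spaces. -/
abbrev compHausFamily (K : CompHaus.{v}) : Type v := K

/-- Compactly generated spaces (no separation axiom). -/
abbrev IsKSpace (Y : Type v) [TopologicalSpace Y] : Prop :=
  Topology.IsGeneratedBy compHausFamily.{v} Y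

/-- Continuity on the `k`-ification of the source: the composite with every continuous map out of
a compact Hausdorff space is continuous. -/
abbrev KContinuous {Y : Type v} {Z : Type*} [TopologicalSpace Y] [TopologicalSpace Z]
    (g : Y → Z) : Prop :=
  Topology.ContinuousGeneratedBy compHausFamily.{v} g

/-! ### Serre fibrations, weak homotopy equivalences, Serre cofibrant spaces -/

section Spaces

variable {X Y : Type*} [TopologicalSpace X] [TopologicalSpace Y]

/-- The map of based cubes induced by a continuous map. -/
def genLoopMap (f : C(X, Y)) (n : ℕ) (x : X) (p : GenLoop (Fin n) X x) :
    GenLoop (Fin n) Y (f x) :=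
  ⟨f.comp p.1, fun y hy => congrArg f (p.2 y hy)⟩

/-- The induced map `πₙ(X, x) → πₙ(Y, f x)`. -/
def homotopyGroupMap (f : C(X, Y)) (n : ℕ) (x : X) :
    HomotopyGroup (Fin n) X x → HomotopyGroup (Fin n) Y (f x) :=
  Quotient.map (genLoopMap f n x) fun _ _ h => h.comp_continuousMap f

/-- The induced map on path components. -/
def zerothHomotopyMap (f : C(X, Y)) : ZerothHomotopy X → ZerothHomotopy Y :=
  Quotient.map f fun _ _ h => h.map f.continuous

/-- Weak homotopy equivalences: bijective on path components and on all homotopy groups at all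
base points. -/
structure IsWeakHomotopyEquiv (f : C(X, Y)) : Prop where
  bijective_zeroth : Function.Bijective (zerothHomotopyMap f)
  bijective_homotopyGroup : ∀ (n : ℕ) (x : X), Function.Bijective (homotopyGroupMap f n x)

/-- Serre fibrations: the homotopy lifting property for all cubes. -/
def IsSerreFibration (p : C(X, Y)) : Prop :=
  ∀ (n : ℕ) (f : C(Fin n → unitInterval, X)) (H : C((Fin n → unitInterval) × unitInterval, Y)),
    (∀ t, H (t, 0) = p (f t)) →
      ∃ G : C((Fin n → unitInterval) × unitInterval, X),
        (∀ t, G (t, 0) = f t) ∧ ∀ t s, p (G (t, s)) = H (t, s)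

/-- Trivial (Serre) fibrations. -/
structure IsTrivialFibration (p : C(X, Y)) : Prop where
  isSerreFibration : IsSerreFibration p
  isWeakHomotopyEquiv : IsWeakHomotopyEquiv p

/-- Serre cofibrant spaces: the map from the empty space has the left lifting property with respect
to trivial Serre fibrations, i.e. maps to the base of a trivial fibration lift. -/
def IsSerreCofibrant (L : Type v) [TopologicalSpace L] : Prop :=
  ∀ (E B : Type v) [TopologicalSpace E] [TopologicalSpace B] (p : C(E, B)),
    IsTrivialFibration p → ∀ f : C(L, B), ∃ g : C(L, E), p.comp g = f

end Spaces

/-! ### Categories enriched in pointed spaces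

The product written `ab` in multiplicative notation, `a` after `b`, is `b ≫ a`. -/

/-- A category enriched in pointed (compactly generated) spaces with respect to the smash product:
the base points are the zero morphisms, and composition is continuous on the (convenient) product
of mapping spaces and vanishes when one of the factors is the base point. -/
class TopStarCategory (T : Type u) [Category.{v} T] extends HasZeroMorphisms T where
  homTopology (A B : T) : TopologicalSpace (A ⟶ B)
  isKSpace_hom (A B : T) : IsKSpace (A ⟶ B)
  continuous_comp (A B C : T) : KContinuous fun p : (B ⟶ C) × (A ⟶ B) => p.2 ≫ p.1

attribute [reducible, instance] TopStarCategory.homTopology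
attribute [instance] TopStarCategory.isKSpace_hom

/-- A `TopStarCategory` is left linear if the mapping spaces are topological monoids, written
additively but not assumed commutative, whose neutral elements are the base points, and
`(x + x')y = xy + x'y`. -/
class LeftLinear (T : Type u) [Category.{v} T] [TopStarCategory T] where
  add {A B : T} : (A ⟶ B) → (A ⟶ B) → (A ⟶ B)
  add_assoc {A B : T} (x y z : A ⟶ B) : add (add x y) z = add x (add y z)
  zero_add {A B : T} (x : A ⟶ B) : add 0 x = x
  add_zero {A B : T} (x : A ⟶ B) : add x 0 = x
  continuous_add (A B : T) : KContinuous fun p : (A ⟶ B) × (A ⟶ B) => add p.1 p.2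
  comp_add {X A B : T} (y : X ⟶ A) (x x' : A ⟶ B) : y ≫ add x x' = add (y ≫ x) (y ≫ x')

instance homAdd {T : Type u} [Category.{v} T] [TopStarCategory T] [LeftLinear T]
    (A B : T) : Add (A ⟶ B) :=
  ⟨LeftLinear.add⟩

instance homAddMonoid {T : Type u} [Category.{v} T] [TopStarCategory T] [LeftLinear T]
    (A B : T) : AddMonoid (A ⟶ B) where
  zero := 0
  add_assoc := LeftLinear.add_assoc
  zero_add := LeftLinear.zero_add
  add_zero := LeftLinear.add_zero
  nsmul := nsmulRec

/-- A mapping theory: a (small) `TopStarCategory` with finite products.  Products are meant in the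
enriched sense, i.e. the continuous bijection from `Hom(X, ∏ᵢ Fᵢ)` to `∏ᵢ Hom(X, Fᵢ)` has a
continuous inverse. -/
class MappingTheory (T : Type u) [Category.{v} T] [TopStarCategory T] : Prop
    extends HasFiniteProducts T where
  continuous_lift (n : ℕ) (F : Fin n → T) (X : T) :
    KContinuous fun x : ∀ i, X ⟶ F i => Pi.lift x

section WeaklyBilinear

variable {T : Type u} [Category.{v} T] [TopStarCategory T]

theorem continuous_precomp {A B : T} (i : A ⟶ B) (Z : T) :
    Continuous fun f : B ⟶ Z => i ≫ f := by
  rw [Topology.IsGeneratedBy.continuous_iff (X := compHausFamily.{v})]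
  intro K g
  exact TopStarCategory.continuous_comp A B Z (i := K)
    ⟨fun k => (g k, i), g.continuous.prodMk continuous_const⟩

/-- The map `(i_A^*, i_B^*) : Hom(A × B, Z) → Hom(A, Z) × Hom(B, Z)` given by restriction along
`i_A = (1, 0)` and `i_B = (0, 1)`.  The target carries the usual product topology; being a Serre
fibration or a weak homotopy equivalence is tested on maps out of cubes and therefore does not
change under `k`-ification of the target. -/
noncomputable def restrictionMap [HasFiniteProducts T] (A B Z : T) :
    C(A ⨯ B ⟶ Z, (A ⟶ Z) × (B ⟶ Z)) where
  toFun f := (prod.lift (𝟙 A) 0 ≫ f, prod.lift 0 (𝟙 B) ≫ f)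
  continuous_toFun := (continuous_precomp _ Z).prodMk (continuous_precomp _ Z)

variable (T) in
/-- Weakly bilinear mapping theories: left linear mapping theories in which all the maps
`(i_A^*, i_B^*)` are trivial fibrations. -/
def IsWeaklyBilinear [LeftLinear T] [MappingTheory T] : Prop :=
  ∀ A B Z : T, IsTrivialFibration (restrictionMap A B Z)

end WeaklyBilinear

/-! ### Distributors -/

section Distributors

variable (T : Type u) [Category.{v} T] [TopStarCategory T]

/-- A collection of `m`-cubes `φ_a^{x_0, …, x_m} : I^m → Hom(X, B)`, for all `a : A ⟶ B` and
`x_0, …, x_m : X ⟶ A`. -/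
def CubeFamily (m : ℕ) : Type (max u v) :=
  ∀ ⦃X A B : T⦄, (A ⟶ B) → (Fin (m + 1) → (X ⟶ A)) → C(Fin m → unitInterval, X ⟶ B)

/-- An `n`-distributor: continuous collections `φ^0, …, φ^n` of cubes with `φ^0 = (ax)` which
satisfy the boundary conditions.  With cube coordinates `t_1, …, t_m` numbered from `0` to `m - 1`,
the coordinate `t_j` has index `j - 1`. -/
structure Distributor [LeftLinear T] (n : ℕ) where
  cube (m : ℕ) (hm : m ≤ n) : CubeFamily T m
  /-- `φ_a^x = ax`. -/
  cube_zero : ∀ ⦃X A B : T⦄ (a : A ⟶ B) (x : Fin 1 → (X ⟶ A)) (t : Fin 0 → unitInterval),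
    cube 0 (Nat.zero_le n) a x t = x 0 ≫ a
  /-- If `t_j = 0`, the value is
  `φ_a^{x_0, …, x_{j-1} + x_j, …, x_m}(t_1, …, t_j omitted, …, t_m)`; here `m = k + 1`. -/
  cube_face_zero : ∀ (k : ℕ) (hk : k + 1 ≤ n) ⦃X A B : T⦄ (a : A ⟶ B)
    (x : Fin (k + 2) → (X ⟶ A)) (t : Fin (k + 1) → unitInterval) (j : Fin (k + 1)), t j = 0 →
      cube (k + 1) hk a x t =
        cube k (by omega) a (Fin.contractNth j.castSucc (· + ·) x) (fun i => t (j.succAbove i))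
  /-- If `t_j = 1`, the value is
  `φ_a^{x_0, …, x_{j-1}}(t_1, …, t_{j-1}) + φ_a^{x_j, …, x_m}(t_{j+1}, …, t_m)`; here `p = j - 1`
  and `q = m - j`. -/
  cube_face_one : ∀ (p q : ℕ) (hpq : p + q + 1 ≤ n) ⦃X A B : T⦄ (a : A ⟶ B)
    (x : Fin (p + q + 2) → (X ⟶ A)) (t : Fin (p + q + 1) → unitInterval),
    t ⟨p, by omega⟩ = 1 →
      cube (p + q + 1) hpq a x t =
        cube p (by omega) a (fun i => x ⟨i, by omega⟩) (fun i => t ⟨i, by omega⟩) +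
          cube q (by omega) a (fun i => x ⟨p + 1 + i, by omega⟩)
            (fun i => t ⟨p + 1 + i, by omega⟩)
  /-- Continuity in the inputs. -/
  continuous_cube : ∀ (m : ℕ) (hm : m ≤ n) (X A B : T),
    KContinuous fun y : (A ⟶ B) × (Fin (m + 1) → (X ⟶ A)) => cube m hm y.1 y.2

variable {T}

namespace Distributor

variable [LeftLinear T] {n : ℕ}

/-- The top-dimensional cubes `φ^n` of an `n`-distributor. -/
def top (φ : Distributor T n) : CubeFamily T n := φ.cube n le_rfl

/-- `ψ = ψ^{n+1}` is based on the `n`-distributor `φ`. -/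
def IsBasedOn (ψ : Distributor T (n + 1)) (φ : Distributor T n) : Prop :=
  ∀ (m : ℕ) (hm : m ≤ n), ψ.cube m (hm.trans n.le_succ) = φ.cube m hm

/-- Good distributors. -/
structure IsGood [MappingTheory T] (φ : Distributor T n) : Prop where
  /-- `φ_a^{x_0, …, x_n} = φ_a^{p_0, …, p_n} ⊗ (x_0, …, x_n)`, where `p_i : A^{n+1} → A` are the
  projections. -/
  universality : ∀ ⦃X A B : T⦄ (a : A ⟶ B) (x : Fin (n + 1) → (X ⟶ A)) (t : Fin n → unitInterval),
    φ.top a x t = Pi.lift x ≫ φ.top a (Pi.π fun _ : Fin (n + 1) => A) t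
  /-- `φ_a^{0, …, x, …, 0}` is the constant cube at `ax`. -/
  wedge : ∀ ⦃X A B : T⦄ (a : A ⟶ B) (x : X ⟶ A) (k : Fin (n + 1)) (t : Fin n → unitInterval),
    φ.top a (Pi.single k x) t = x ≫ a

end Distributor

/-- A homotopy relative to `∂I^m` between two collections of `m`-cubes, continuous in all the
inputs. -/
structure CubeFamily.HomotopyRelBoundary {m : ℕ} (φ ψ : CubeFamily T m) where
  toFun : unitInterval → CubeFamily T m
  map_zero : toFun 0 = φ
  map_one : toFun 1 = ψ
  rel_boundary : ∀ (s : unitInterval) ⦃X A B : T⦄ (a : A ⟶ B) (x : Fin (m + 1) → (X ⟶ A)),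
    ∀ t ∈ Cube.boundary (Fin m), toFun s a x t = φ a x t
  continuous_toFun : ∀ X A B : T,
    KContinuous fun y : unitInterval × (A ⟶ B) × (Fin (m + 1) → (X ⟶ A)) =>
      toFun y.1 y.2.1 y.2.2

end Distributors

end HigherDist

/-!
A good distributor of dimension `n + 1` is determined by its universal cubes
`φ_a^{p_0, …, p_{n+1}}`, one for every `a : A ⟶ B`, in the space of maps `A^{n+2} ⟶ B`; all other
cubes arise from them by precomposition with tuples (`Distributor.IsGood.exists_extension`).  The
boundary conditions prescribe the universal cubes on `∂I^{n+1}`, and the wedge condition prescribes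
their restrictions to the `n + 2` axes of `A^{n+2}`.  Hence the universal cubes solve a family,
parametrized by `a`, of lifting problems of `∂I^{n+1} ⊆ I^{n+1}` against the restriction to the axes
`Hom(A^{n+2}, B) → Hom(A, B)^{n+2}`.  Homotopies of good distributors relative to the boundary are
solutions of such families for `∂(I^{n+1} × I) ⊆ I^{n+1} × I`.

* The restriction to the axes is an iterate of the maps `(i_A^*, i_B^*)`, which are trivial
  fibrations (`hasCubeLifting_axesRestriction`).
* Trivial Serre fibrations, which are defined by homotopy lifting and by homotopy groups, are
  exactly the maps with the right lifting property for all `∂Iᵏ ⊆ Iᵏ`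
  (`IsTrivialFibration.hasCubeLifting`, `HasCubeLifting.isTrivialFibration`).
* The solutions of a family of lifting problems parametrized by a space `L` form a space over `L`,
  whose projection inherits the lifting property.  It is therefore a trivial fibration, and has a
  section if `L` is cofibrant (`HasCubeLifting.exists_family_lift`).
* The prescribed values on the faces of `I^{n+1}` agree on the intersections of faces by the boundary
  conditions for `φ` and associativity of addition (`Distributor.exists_boundary`), and they are
  compatible with the prescribed restrictions to the axes because the lower cubes of a good
  distributor are natural and constant on the axes too (`Distributor.IsGood.comp_val`,
  `Distributor.IsGood.val_single`).

Partially defined maps are encoded as total functions that are continuous on the given subset.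
-/

namespace HigherDist

open Set Topology unitInterval

/-! ### Gluing partially defined maps -/

section Gluing

variable {Z Y : Type*} [TopologicalSpace Z] [TopologicalSpace Y]

theorem exists_continuousOn_union {A B : Set Z} (hA : IsClosed A) (hB : IsClosed B) {f g : Z → Y}
    (hf : ContinuousOn f A) (hg : ContinuousOn g B) (hfg : ∀ z ∈ A, z ∈ B → f z = g z) :
    ∃ h : Z → Y, ContinuousOn h (A ∪ B) ∧ EqOn h f A ∧ EqOn h g B := by
  classical
  have h1 : EqOn (A.piecewise f g) f A := fun z hz => piecewise_eq_of_mem _ _ _ hz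
  have h2 : EqOn (A.piecewise f g) g B := fun z hz => by
    by_cases hzA : z ∈ A
    · rw [h1 hzA, hfg z hzA hz]
    · exact piecewise_eq_of_notMem _ _ _ hzA
  exact ⟨A.piecewise f g, (hf.congr h1).union_of_isClosed (hg.congr h2) hA hB, h1, h2⟩

theorem exists_continuousOn_iUnion {κ : Type*} [Finite κ] [Nonempty κ] {C : κ → Set Z}
    (hC : ∀ i, IsClosed (C i)) (G : κ → Z → Y) (hG : ∀ i, ContinuousOn (G i) (C i))
    (hGG : ∀ i j, ∀ z ∈ C i, z ∈ C j → G i z = G j z) :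
    ∃ h : Z → Y, ContinuousOn h (⋃ i, C i) ∧ ∀ i, EqOn h (G i) (C i) := by
  classical
  let h : Z → Y := fun z =>
    if hz : ∃ i, z ∈ C i then G hz.choose z else G (Classical.arbitrary κ) z
  have hh : ∀ i, EqOn h (G i) (C i) := fun i z hz => by
    have hz' : ∃ i, z ∈ C i := ⟨i, hz⟩
    simp only [h, dif_pos hz']
    exact hGG _ _ z hz'.choose_spec hz
  exact ⟨h, (locallyFinite_of_finite C).continuousOn_iUnion hC fun i => (hG i).congr (hh i), hh⟩

end Gluing

/-! ### The homotopy extension property of the boundary of a cube -/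

section Cubes

variable {ι : Type*}

theorem isClosed_boundary [Finite ι] : IsClosed (Cube.boundary ι) := by
  have : Cube.boundary ι = ⋃ i, {y : ι → I | y i = 0 ∨ y i = 1} := by
    ext y; simp [Cube.boundary]
  rw [this]
  refine isClosed_iUnion_of_finite fun i => ?_
  exact (isClosed_eq (continuous_apply i) continuous_const).union
    (isClosed_eq (continuous_apply i) continuous_const)

variable (ι) in
/-- The part `I^ι × {0} ∪ ∂I^ι × I` of the cylinder on a cube. -/
def openBox : Set ((ι → I) × I) := {y | y.2 = 0} ∪ {y | y.1 ∈ Cube.boundary ι}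

theorem isClosed_openBox [Finite ι] : IsClosed (openBox ι) :=
  (isClosed_eq continuous_snd continuous_const).union
    (isClosed_boundary.preimage continuous_fst)

variable [Fintype ι]

/-- The distance from the centre of the cube in the maximum norm, normalized to be `1` on the
boundary. -/
noncomputable def cubeNorm (x : ι → I) : ℝ := ‖fun i => 2 * (x i : ℝ) - 1‖

theorem continuous_cubeNorm : Continuous (cubeNorm : (ι → I) → ℝ) := by
  unfold cubeNorm; fun_prop

theorem abs_le_cubeNorm (x : ι → I) (i : ι) : |2 * (x i : ℝ) - 1| ≤ cubeNorm x :=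
  norm_le_pi_norm (fun i => 2 * (x i : ℝ) - 1) i

theorem cubeNorm_le_one (x : ι → I) : cubeNorm x ≤ 1 := by
  refine (pi_norm_le_iff_of_nonneg zero_le_one).2 fun i => abs_le.2 ?_
  constructor <;> linarith [(x i).2.1, (x i).2.2]

theorem cubeNorm_eq_one {x : ι → I} (hx : x ∈ Cube.boundary ι) : cubeNorm x = 1 := by
  refine le_antisymm (cubeNorm_le_one x) ?_
  obtain ⟨i, hi⟩ := hx
  refine le_trans ?_ (abs_le_cubeNorm x i)
  rcases hi with hi | hi <;> rw [hi] <;> norm_num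

theorem exists_abs_eq_cubeNorm {x : ι → I} (hx : 0 < cubeNorm x) :
    ∃ i, |2 * (x i : ℝ) - 1| = cubeNorm x := by
  by_contra! h
  exact lt_irrefl _ ((pi_norm_lt_iff hx).2 fun i => lt_of_le_of_ne (abs_le_cubeNorm x i) (h i))

/-- The inverse of the factor by which the radial projection from the point `(1/2, …, 1/2, 2)` onto
the open box stretches. -/
noncomputable def boxScale (y : (ι → I) × I) : ℝ := max (cubeNorm y.1) ((2 - y.2) / 2)

theorem continuous_boxScale : Continuous (boxScale : (ι → I) × I → ℝ) := by
  have := continuous_cubeNorm (ι := ι)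
  unfold boxScale; fun_prop

theorem half_le_boxScale (y : (ι → I) × I) : 1 / 2 ≤ boxScale y :=
  le_max_of_le_right (by linarith [y.2.2.2])

theorem boxScale_le_one (y : (ι → I) × I) : boxScale y ≤ 1 :=
  max_le (cubeNorm_le_one _) (by linarith [y.2.2.1])

theorem boxScale_eq_one {y : (ι → I) × I} (hy : y ∈ openBox ι) : boxScale y = 1 := by
  refine le_antisymm (boxScale_le_one y) ?_
  rcases hy with hy | hy
  · exact le_max_of_le_right (by rw [show y.2 = 0 from hy]; norm_num)
  · exact le_max_of_le_left (cubeNorm_eq_one hy).ge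

variable (ι) in
/-- The inclusion of the open box is a retract of the inclusion of the bottom of a cylinder: the
point `r (y, τ)` arises from `y` by stretching from `(1/2, …, 1/2, 2)` by the factor
`max ((boxScale y)⁻¹ - τ) 1`.  It lies in the open box for `τ = 0`, and it is `y` for `τ = ht y`,
where `ht y = (boxScale y)⁻¹ - 1` vanishes on the open box. -/
theorem exists_boxFlow : ∃ (r : C(((ι → I) × I) × I, (ι → I) × I)) (ht : C((ι → I) × I, I)),
    (∀ y, r (y, 0) ∈ openBox ι) ∧ (∀ y, r (y, ht y) = y) ∧ ∀ y ∈ openBox ι, ht y = 0 := by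
  have hpos : ∀ y : (ι → I) × I, 0 < boxScale y := fun y =>
    lt_of_lt_of_le (by norm_num) (half_le_boxScale y)
  have hinv : Continuous fun y : (ι → I) × I => (boxScale y)⁻¹ :=
    continuous_boxScale.inv₀ fun y => (hpos y).ne'
  let sc : ((ι → I) × I) × I → ℝ := fun z => max ((boxScale z.1)⁻¹ - z.2) 1
  have hsc : Continuous sc := by
    have := hinv.comp (continuous_fst (X := (ι → I) × I) (Y := I))
    simp only [Function.comp_def] at this
    fun_prop
  let proj : ℝ → I := projIcc 0 1 zero_le_one
  have hproj : Continuous proj := continuous_projIcc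
  let r : C(((ι → I) × I) × I, (ι → I) × I) :=
    ⟨fun z => (fun i => proj ((1 + (2 * (z.1.1 i : ℝ) - 1) * sc z) / 2),
      proj (2 - (2 - z.1.2) * sc z)), by fun_prop⟩
  have hone : ∀ y, 1 ≤ (boxScale y)⁻¹ := fun y => (one_le_inv₀ (hpos y)).2 (boxScale_le_one y)
  have htwo : ∀ y, (boxScale y)⁻¹ ≤ 2 := fun y => by
    rw [inv_le_comm₀ (hpos y) two_pos]; linarith [half_le_boxScale y]
  have hone_iff : ∀ s : I, proj s = s := fun s => projIcc_val _ s
  refine ⟨r, ⟨fun y => proj ((boxScale y)⁻¹ - 1), by fun_prop⟩, fun y => ?_, fun y => ?_,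
    fun y hy => ?_⟩
  · have hs : sc (y, 0) = (boxScale y)⁻¹ := by simp [sc, hone y]
    rcases max_choice (cubeNorm y.1) ((2 - y.2) / 2 : ℝ) with h | h
    · have h' : boxScale y = cubeNorm y.1 := h
      obtain ⟨i, hi⟩ := exists_abs_eq_cubeNorm (h' ▸ hpos y)
      refine Or.inr ⟨i, ?_⟩
      change proj ((1 + (2 * (y.1 i : ℝ) - 1) * sc (y, 0)) / 2) = 0 ∨
        proj ((1 + (2 * (y.1 i : ℝ) - 1) * sc (y, 0)) / 2) = 1
      rw [hs]
      rw [← h'] at hi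
      rcases abs_choice (2 * (y.1 i : ℝ) - 1) with h'' | h''
      · right
        rw [← h'', hi, mul_inv_cancel₀ (hpos y).ne']
        exact projIcc_of_right_le _ (by norm_num)
      · left
        rw [show 2 * (y.1 i : ℝ) - 1 = -boxScale y by linarith, neg_mul,
          mul_inv_cancel₀ (hpos y).ne']
        exact projIcc_of_le_left _ (by norm_num)
    · have h' : (2 - y.2 : ℝ) = 2 * boxScale y := by
        have : boxScale y = (2 - y.2) / 2 := h
        linarith
      left
      change proj (2 - (2 - y.2) * sc (y, 0)) = 0
      rw [hs, h', mul_assoc, mul_inv_cancel₀ (hpos y).ne']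
      exact projIcc_of_le_left _ (by norm_num)
  · have hs : sc (y, proj ((boxScale y)⁻¹ - 1)) = 1 := by
      have : (proj ((boxScale y)⁻¹ - 1) : ℝ) = (boxScale y)⁻¹ - 1 := by
        simp only [proj]
        rw [projIcc_of_mem _ ⟨by linarith [hone y], by linarith [htwo y]⟩]
      simp only [sc, this]
      simp
    refine Prod.ext (funext fun i => ?_) ?_
    · change proj ((1 + (2 * (y.1 i : ℝ) - 1) * sc (y, proj ((boxScale y)⁻¹ - 1))) / 2) = _
      rw [hs, ← hone_iff (y.1 i)]
      congr 1
      rw [hone_iff]; ring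
    · change proj (2 - (2 - y.2) * sc (y, proj ((boxScale y)⁻¹ - 1))) = _
      rw [hs, ← hone_iff y.2]
      congr 1
      rw [hone_iff]; ring
  · change proj ((boxScale y)⁻¹ - 1) = 0
    rw [boxScale_eq_one hy]
    exact projIcc_of_le_left _ (by norm_num)

/-- The homotopy extension property of `∂I^ι ⊆ I^ι`. -/
theorem exists_homotopy_extension {Y : Type*} [TopologicalSpace Y] (u : C(ι → I, Y))
    {w : (ι → I) × I → Y} (hw : ContinuousOn w {y | y.1 ∈ Cube.boundary ι})
    (huw : ∀ t ∈ Cube.boundary ι, w (t, 0) = u t) :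
    ∃ W : C((ι → I) × I, Y), (∀ t, W (t, 0) = u t) ∧ ∀ t ∈ Cube.boundary ι, ∀ s,
      W (t, s) = w (t, s) := by
  obtain ⟨r, ht, h0, h1, h2⟩ := exists_boxFlow ι
  obtain ⟨φ, hφ, hφu, hφw⟩ := exists_continuousOn_union
    (A := {y : (ι → I) × I | y.2 = 0}) (B := {y | y.1 ∈ Cube.boundary ι})
    (isClosed_eq continuous_snd continuous_const) (isClosed_boundary.preimage continuous_fst)
    (f := fun y => u y.1) (g := w) (by fun_prop) hw (by
      rintro ⟨t, s⟩ (rfl : s = 0) ht; exact (huw t ht).symm)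
  have hr : ∀ y ∈ openBox ι, r (y, 0) = y := fun y hy => by
    conv_rhs => rw [← h1 y, h2 y hy]
  refine ⟨⟨fun y => φ (r (y, 0)), hφ.comp_continuous (by fun_prop) h0⟩, fun t => ?_,
    fun t ht s => ?_⟩
  · change φ (r ((t, 0), 0)) = _
    rw [hr _ (Or.inl rfl)]
    exact hφu rfl
  · change φ (r ((t, s), 0)) = _
    rw [hr _ (Or.inr ht)]
    exact hφw ht

end Cubes

/-! ### Lifting problems -/

section Lifting

variable {E B Z W : Type*} [TopologicalSpace E] [TopologicalSpace B] [TopologicalSpace Z]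
  [TopologicalSpace W]

/-- All lifting problems of `D ⊆ Z` against `p` whose upper map is `g` have a solution.  Only the
values of `g` on `D` matter. -/
def LiftsAt (p : C(E, B)) (D : Set Z) (g : Z → E) : Prop :=
  ∀ f : C(Z, B), (∀ z ∈ D, p (g z) = f z) →
    ∃ h : C(Z, E), (∀ z ∈ D, h z = g z) ∧ ∀ z, p (h z) = f z

/-- The inclusion of `D` into `Z` has the left lifting property with respect to `p`. -/
def HasLifting (p : C(E, B)) (D : Set Z) : Prop :=
  ∀ g : Z → E, ContinuousOn g D → LiftsAt p D g

/-- The right lifting property with respect to the inclusions of the boundaries of cubes.  In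
dimension zero this is surjectivity, which has to be stated separately: a partially defined map is
encoded by a total one, and there is none to an empty space. -/
structure HasCubeLifting (p : C(E, B)) : Prop where
  surjective : Function.Surjective p
  hasLifting (n : ℕ) : HasLifting p (Cube.boundary (Fin n))

variable {p : C(E, B)}

theorem LiftsAt.congr {D : Set Z} {g g' : Z → E} (hg : LiftsAt p D g) (h : EqOn g g' D) :
    LiftsAt p D g' := fun f hf => by
  obtain ⟨k, hk, hk'⟩ := hg f fun z hz => by rw [h hz, hf z hz]
  exact ⟨k, fun z hz => by rw [hk z hz, h hz], hk'⟩

theorem liftsAt_comp_homeomorph (e : Z ≃ₜ W) {D : Set W} {g : W → E} :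
    LiftsAt p (e ⁻¹' D) (g ∘ e) ↔ LiftsAt p D g := by
  constructor
  · intro h f hf
    obtain ⟨k, hk, hk'⟩ := h (f.comp e) fun z hz => hf _ hz
    refine ⟨k.comp e.symm, fun z hz => ?_, fun z => ?_⟩
    · have := hk (e.symm z) (by simpa using hz)
      simpa using this
    · have := hk' (e.symm z)
      simpa using this
  · intro h f hf
    obtain ⟨k, hk, hk'⟩ := h (f.comp e.symm) fun z hz => by
      have := hf (e.symm z) (by simpa using hz)
      simpa using this
    refine ⟨k.comp e, fun z hz => hk _ hz, fun z => ?_⟩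
    have := hk' (e z)
    simpa using this

theorem HasLifting.comp_homeomorph {D : Set W} (h : HasLifting p D) (e : Z ≃ₜ W) :
    HasLifting p (e ⁻¹' D) := fun g hg => by
  have : g = (g ∘ e.symm) ∘ e := by ext; simp
  rw [this, liftsAt_comp_homeomorph]
  exact h _ (hg.comp (by fun_prop) fun z hz => by simpa using hz)

theorem boundary_piCongrLeft {ι κ : Type*} (e : ι ≃ κ) :
    Homeomorph.piCongrLeft (Y := fun _ => I) e ⁻¹' Cube.boundary κ = Cube.boundary ι := by
  ext y
  have h : ∀ i, Homeomorph.piCongrLeft (Y := fun _ => I) e y (e i) = y i := fun i =>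
    Equiv.piCongrLeft_apply_apply (fun _ => I) e y i
  constructor
  · rintro ⟨j, hj⟩
    obtain ⟨i, rfl⟩ := e.surjective j
    exact ⟨i, by rwa [h] at hj⟩
  · rintro ⟨i, hi⟩
    exact ⟨e i, by rwa [h]⟩

theorem HasCubeLifting.boundary (hp : HasCubeLifting p) (ι : Type*) [Finite ι] :
    HasLifting p (Cube.boundary ι) := by
  obtain ⟨n, ⟨e⟩⟩ := Finite.exists_equiv_fin ι
  rw [← boundary_piCongrLeft e]
  exact (hp.hasLifting n).comp_homeomorph _

/-- The boundary of the cube `I^ι × I`. -/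
def cylBoundary (ι : Type*) : Set ((ι → I) × I) := openBox ι ∪ {y | y.2 = 1}

/-- The cylinder on a cube as a cube. -/
def cylHomeomorph (ι : Type*) : (ι ⊕ Unit → I) ≃ₜ (ι → I) × I :=
  Homeomorph.sumArrowHomeomorphProdArrow.trans
    ((Homeomorph.refl _).prodCongr (Homeomorph.funUnique Unit I))

theorem preimage_cylBoundary (ι : Type*) :
    cylHomeomorph ι ⁻¹' cylBoundary ι = Cube.boundary (ι ⊕ Unit) := by
  ext y
  constructor
  · rintro ((h | ⟨i, h⟩) | h)
    · exact ⟨Sum.inr (), Or.inl h⟩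
    · exact ⟨Sum.inl i, h⟩
    · exact ⟨Sum.inr (), Or.inr h⟩
  · rintro ⟨i | i, h⟩
    · exact Or.inl (Or.inr ⟨i, h⟩)
    · exact h.elim (fun h => Or.inl (Or.inl h)) Or.inr

theorem hasLifting_cylBoundary {ι : Type*} (h : HasLifting p (Cube.boundary (ι ⊕ Unit))) :
    HasLifting p (cylBoundary ι) := by
  have := h.comp_homeomorph (cylHomeomorph ι).symm
  rwa [← preimage_cylBoundary, ← preimage_comp, Homeomorph.self_comp_symm, preimage_id] at this

/-- Solving a lifting problem on `I^ι × I` whose upper map is given separately on the two ends and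
on the sides. -/
theorem HasCubeLifting.exists_lift_cylinder {ι : Type*} [Finite ι] (hp : HasCubeLifting p)
    (f : C((ι → I) × I, B)) (u₀ u₁ : C(ι → I, E)) {w : (ι → I) × I → E}
    (hw : ContinuousOn w {y | y.1 ∈ Cube.boundary ι}) (h₀ : ∀ t, p (u₀ t) = f (t, 0))
    (h₁ : ∀ t, p (u₁ t) = f (t, 1)) (hf : ∀ t ∈ Cube.boundary ι, ∀ s, p (w (t, s)) = f (t, s))
    (hw₀ : ∀ t ∈ Cube.boundary ι, w (t, 0) = u₀ t)
    (hw₁ : ∀ t ∈ Cube.boundary ι, w (t, 1) = u₁ t) :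
    ∃ h : C((ι → I) × I, E), (∀ t, h (t, 0) = u₀ t) ∧ (∀ t, h (t, 1) = u₁ t) ∧
      (∀ t ∈ Cube.boundary ι, ∀ s, h (t, s) = w (t, s)) ∧ ∀ y, p (h y) = f y := by
  have hc₀ : IsClosed {y : (ι → I) × I | y.2 = 0} := isClosed_eq continuous_snd continuous_const
  have hc₁ : IsClosed {y : (ι → I) × I | y.2 = 1} := isClosed_eq continuous_snd continuous_const
  obtain ⟨φ, hφ, hφu, hφw⟩ := exists_continuousOn_union hc₀
    (isClosed_boundary.preimage continuous_fst) (f := fun y => u₀ y.1) (g := w) (by fun_prop) hw (by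
      rintro ⟨t, s⟩ (rfl : s = 0) ht; exact (hw₀ t ht).symm)
  obtain ⟨χ, hχ, hχφ, hχu⟩ := exists_continuousOn_union isClosed_openBox hc₁ (f := φ)
    (g := fun y => u₁ y.1) hφ (by fun_prop) (by
      rintro ⟨t, s⟩ (hs | ht) (rfl : s = 1)
      · exact absurd hs one_ne_zero
      · exact (hφw ht).trans (hw₁ t ht))
  obtain ⟨h, hh, hpf⟩ := hasLifting_cylBoundary (hp.boundary (ι ⊕ Unit)) χ hχ f (by
    rintro ⟨t, s⟩ ((hs | ht) | hs)
    · rw [hχφ (Or.inl hs), hφu hs, show s = 0 from hs]; exact h₀ t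
    · rw [hχφ (Or.inr ht), hφw ht]; exact hf t ht s
    · rw [hχu hs, show s = 1 from hs]; exact h₁ t)
  refine ⟨h, fun t => ?_, fun t => ?_, fun t ht s => ?_, hpf⟩
  · rw [hh _ (Or.inl (Or.inl rfl)), hχφ (Or.inl rfl), hφu rfl]
  · rw [hh _ (Or.inr rfl), hχu rfl]
  · rw [hh _ (Or.inl (Or.inr ht)), hχφ (Or.inr ht), hφw ht]

end Lifting

/-! ### Trivial Serre fibrations lift cubes relative to their boundary -/

section TrivialFibration

variable {E B : Type*} [TopologicalSpace E] [TopologicalSpace B] {p : C(E, B)}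

theorem IsSerreFibration.exists_homotopy_lift (hp : IsSerreFibration p) {ι : Type*} [Finite ι]
    (f : C(ι → I, E)) (H : C((ι → I) × I, B)) (hf : ∀ t, H (t, 0) = p (f t)) :
    ∃ G : C((ι → I) × I, E), (∀ t, G (t, 0) = f t) ∧ ∀ y, p (G y) = H y := by
  obtain ⟨n, ⟨e⟩⟩ := Finite.exists_equiv_fin ι
  let k := Homeomorph.piCongrLeft (Y := fun _ => I) e
  obtain ⟨G, hG, hG'⟩ := hp n (f.comp k.symm) (H.comp (k.symm.prodCongr (Homeomorph.refl I)))
    fun t => by simpa using hf (k.symm t)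
  refine ⟨G.comp (k.prodCongr (Homeomorph.refl I)), fun t => ?_, fun y => ?_⟩
  · have := hG (k t)
    simpa using this
  · have := hG' (k y.1) y.2
    change p (G (k y.1, y.2)) = H y
    simpa using this

/-- A Serre fibration has the relative homotopy lifting property for `∂I^ι ⊆ I^ι`. -/
theorem IsSerreFibration.exists_lift_openBox (hp : IsSerreFibration p) {ι : Type*} [Fintype ι]
    (f : C((ι → I) × I, B)) (u : C(ι → I, E)) {w : (ι → I) × I → E}
    (hw : ContinuousOn w {y | y.1 ∈ Cube.boundary ι}) (hfu : ∀ t, p (u t) = f (t, 0))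
    (hfw : ∀ t ∈ Cube.boundary ι, ∀ s, p (w (t, s)) = f (t, s))
    (huw : ∀ t ∈ Cube.boundary ι, w (t, 0) = u t) :
    ∃ h : C((ι → I) × I, E), (∀ t, h (t, 0) = u t) ∧
      (∀ t ∈ Cube.boundary ι, ∀ s, h (t, s) = w (t, s)) ∧ ∀ y, p (h y) = f y := by
  obtain ⟨r, ht, h0, h1, h2⟩ := exists_boxFlow ι
  obtain ⟨W, hW, hW'⟩ := exists_homotopy_extension u hw huw
  have hWf : ∀ y ∈ openBox ι, p (W y) = f y := by
    rintro ⟨t, s⟩ (hs | ht)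
    · rw [show s = 0 from hs, hW, hfu]
    · rw [hW' t ht, hfw t ht]
  have hr : ∀ y ∈ openBox ι, r (y, 0) = y := fun y hy => by
    conv_rhs => rw [← h1 y, h2 y hy]
  let e := cylHomeomorph ι
  obtain ⟨G, hG, hG'⟩ := hp.exists_homotopy_lift
    (⟨fun y => W (r (e y, 0)), by fun_prop⟩ : C(ι ⊕ Unit → I, E))
    (⟨fun y => f (r (e y.1, y.2)), by fun_prop⟩ : C((ι ⊕ Unit → I) × I, B))
    fun t => (hWf _ (h0 _)).symm
  -- `y ↦ G (y, ht y)` is the lift: it lies over `r (y, ht y) = y`, and on the open box `ht = 0`.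
  have key : ∀ y ∈ openBox ι, G (e.symm y, ht y) = W y := fun y hy => by
    rw [h2 y hy, hG]
    change W (r (e (e.symm y), 0)) = W y
    rw [e.apply_symm_apply, hr y hy]
  refine ⟨⟨fun y => G (e.symm y, ht y), by fun_prop⟩, fun t => ?_, fun t ht s => ?_, fun y => ?_⟩
  · exact (key _ (Or.inl rfl)).trans (hW t)
  · exact (key _ (Or.inr ht)).trans (hW' t ht s)
  · change p (G (e.symm y, ht y)) = f y
    rw [hG']
    change f (r (e (e.symm y), ht y)) = f y
    rw [e.apply_symm_apply, h1]

/-- Whether the lifting problems with a given upper map have solutions depends only on the homotopy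
class of the upper map. -/
theorem IsSerreFibration.liftsAt_of_homotopy (hp : IsSerreFibration p) {ι : Type*} [Fintype ι]
    {G : (ι → I) × I → E} (hG : ContinuousOn G {y | y.1 ∈ Cube.boundary ι})
    (h1 : LiftsAt p (Cube.boundary ι) fun t => G (t, 1)) :
    LiftsAt p (Cube.boundary ι) fun t => G (t, 0) := by
  intro f hf
  obtain ⟨F, hF, hF'⟩ := exists_homotopy_extension f (w := fun y => p (G y))
    (p.continuous.comp_continuousOn hG) hf
  obtain ⟨k, hk, hk'⟩ := h1 ⟨fun t => F (t, 1), by fun_prop⟩ fun t ht => (hF' t ht 1).symm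
  -- Lift the homotopy of lower maps backwards, starting from the solution `k` at time `1`.
  obtain ⟨K, -, hK, hK'⟩ := hp.exists_lift_openBox
    (⟨fun y => F (y.1, σ y.2), by fun_prop⟩ : C((ι → I) × I, B)) k
    (w := fun y => G (y.1, σ y.2))
    (hG.comp (by fun_prop) fun y hy => hy) (fun t => by simp [hk'])
    (fun t ht s => (hF' t ht _).symm) (fun t ht => by simp [hk t ht])
  refine ⟨⟨fun t => K (t, 1), by fun_prop⟩, fun t ht => ?_, fun t => ?_⟩
  · simp [hK t ht]
  · simp [hK', hF]

theorem IsSerreFibration.liftsAt_cylinder_of_homotopy (hp : IsSerreFibration p) {ι : Type*}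
    [Fintype ι] {G : ((ι → I) × I) × I → E} (hG : ContinuousOn G {y | y.1 ∈ cylBoundary ι})
    (h1 : LiftsAt p (cylBoundary ι) fun t => G (t, 1)) :
    LiftsAt p (cylBoundary ι) fun t => G (t, 0) := by
  let e := cylHomeomorph ι
  have he := preimage_cylBoundary ι
  rw [← liftsAt_comp_homeomorph e, he]
  refine hp.liftsAt_of_homotopy (G := fun y => G (e y.1, y.2)) ?_ ?_
  · refine hG.comp (by fun_prop) fun y (hy : y.1 ∈ Cube.boundary _) => ?_
    rwa [← he] at hy
  · rw [← he]
    exact (liftsAt_comp_homeomorph e).2 h1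

theorem homotopyGroupMap_mk (n : ℕ) (x : E) (a : GenLoop (Fin n) E x) :
    homotopyGroupMap p n x ⟦a⟧ = ⟦genLoopMap p n x a⟧ := rfl

/-- Surjectivity on homotopy groups solves the lifting problems with constant upper map. -/
theorem IsTrivialFibration.liftsAt_const (hp : IsTrivialFibration p) (n : ℕ) (x : E) :
    LiftsAt p (Cube.boundary (Fin n)) fun _ => x := by
  intro f hf
  let b : GenLoop (Fin n) B (p x) := ⟨f, fun y hy => (hf y hy).symm⟩
  obtain ⟨q, hq⟩ := (hp.isWeakHomotopyEquiv.bijective_homotopyGroup n x).2 ⟦b⟧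
  obtain ⟨a, rfl⟩ := Quotient.exists_rep q
  rw [homotopyGroupMap_mk] at hq
  obtain ⟨H⟩ : GenLoop.Homotopic _ _ := Quotient.exact hq
  -- `a` solves the problem up to the homotopy `H` relative to the boundary, which can be lifted.
  obtain ⟨K, -, hK, hK'⟩ := hp.isSerreFibration.exists_lift_openBox
    (⟨fun y => H (y.2, y.1), by fun_prop⟩ : C((Fin n → I) × I, B)) a.1 (w := fun _ => x)
    continuousOn_const (fun t => (H.apply_zero t).symm)
    (fun t ht s => by
      refine Eq.symm ((H.eq_fst s ht).trans ?_)
      exact congrArg p (a.2 t ht)) (fun t ht => (a.2 t ht).symm)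
  refine ⟨⟨fun t => K (t, 1), by fun_prop⟩, fun t ht => hK t ht 1, fun t => ?_⟩
  exact (hK' (t, 1)).trans (H.apply_one t)

/-- Gluing a map on the top of a cylinder to a map on the open box, in a family. -/
theorem exists_glue_cylBoundary {Y : Type*} [TopologicalSpace Y] {ι : Type*} [Finite ι]
    {w : ((ι → I) × I) × I → Y} (hw : ContinuousOn w {y | y.1 ∈ openBox ι})
    (v : C((ι → I) × I, Y)) (hvw : ∀ t ∈ Cube.boundary ι, ∀ s, w ((t, 1), s) = v (t, s)) :
    ∃ G : ((ι → I) × I) × I → Y, ContinuousOn G {y | y.1 ∈ cylBoundary ι} ∧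
      (∀ y ∈ openBox ι, ∀ s, G (y, s) = w (y, s)) ∧ ∀ t s, G ((t, 1), s) = v (t, s) := by
  obtain ⟨G, hG, hG1, hG2⟩ := exists_continuousOn_union
    (isClosed_openBox.preimage continuous_fst)
    (B := {y : ((ι → I) × I) × I | y.1.2 = 1}) (isClosed_eq (by fun_prop) continuous_const)
    (f := w) (g := fun y => v (y.1.1, y.2)) hw (by fun_prop) (by
      rintro ⟨⟨t, s⟩, s'⟩ (hs | ht) (rfl : s = 1)
      · exact absurd hs one_ne_zero
      · exact hvw t ht s')
  exact ⟨G, hG, fun y hy s => hG1 (show (y, s).1 ∈ openBox ι from hy),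
    fun t s => hG2 (show ((t, (1 : I)), s).1.2 = 1 from rfl)⟩

/-- Injectivity on homotopy groups solves the lifting problems whose upper map is constant on the
open box: the lower map is a null homotopy of the image of the top of the upper map, which is
therefore null homotopic itself. -/
theorem IsTrivialFibration.liftsAt_cylinder_of_const (hp : IsTrivialFibration p) (n : ℕ) (x : E)
    {g : (Fin n → I) × I → E} (hg : ContinuousOn g (cylBoundary (Fin n)))
    (hx : ∀ y ∈ openBox (Fin n), g y = x) : LiftsAt p (cylBoundary (Fin n)) g := by
  intro f hf
  let a : GenLoop (Fin n) E x := ⟨⟨fun t => g (t, 1),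
    hg.comp_continuous (by fun_prop) fun t => Or.inr rfl⟩, fun t ht => hx _ (Or.inr ht)⟩
  let c : GenLoop (Fin n) E x := ⟨ContinuousMap.const _ x, fun _ _ => rfl⟩
  have hac : (⟦a⟧ : HomotopyGroup (Fin n) E x) = ⟦c⟧ := by
    apply (hp.isWeakHomotopyEquiv.bijective_homotopyGroup n x).1
    rw [homotopyGroupMap_mk, homotopyGroupMap_mk]
    refine Quotient.sound (show GenLoop.Homotopic _ _ from ⟨?_⟩)
    exact
      { toFun := fun y => f (y.2, σ y.1)
        continuous_toFun := by fun_prop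
        map_zero_left := fun t => by
          change f (t, σ 0) = p (g (t, 1))
          simpa using (hf (t, 1) (Or.inr rfl)).symm
        map_one_left := fun t => by
          have := (hf (t, 0) (Or.inl (Or.inl rfl))).symm
          rw [hx _ (Or.inl rfl)] at this
          change f (t, σ 1) = p x
          simpa using this
        prop' := fun s t ht => by
          have := hf (t, σ s) (Or.inl (Or.inr ht))
          rw [hx _ (Or.inr ht)] at this
          refine this.symm.trans ?_
          exact congrArg p (a.2 t ht).symm }
  obtain ⟨H⟩ : GenLoop.Homotopic a c := Quotient.exact hac
  -- The null homotopy `H` of the top deforms `g` to a constant map.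
  obtain ⟨G, hG, hG1, hG2⟩ := exists_glue_cylBoundary (ι := Fin n) (w := fun _ => x)
    continuousOn_const (⟨fun y => H (y.2, y.1), by fun_prop⟩ : C((Fin n → I) × I, E))
    fun t ht s => ((H.eq_fst s ht).trans (a.2 t ht)).symm
  have hGg : EqOn (fun y => G (y, 0)) g (cylBoundary (Fin n)) := by
    rintro ⟨t, s⟩ (hy | hs)
    · exact (hG1 _ hy 0).trans (hx _ hy).symm
    · obtain rfl : s = 1 := hs
      exact (hG2 t 0).trans (H.apply_zero t)
  refine LiftsAt.congr (hp.isSerreFibration.liftsAt_cylinder_of_homotopy hG ?_) hGg f hf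
  have hconst : LiftsAt p (cylBoundary (Fin n)) fun _ => x := by
    obtain ⟨e⟩ : Nonempty (Fin n ⊕ Unit ≃ Fin (n + 1)) :=
      Finite.card_eq.1 (by simp)
    rw [← liftsAt_comp_homeomorph (cylHomeomorph (Fin n)), preimage_cylBoundary,
      ← boundary_piCongrLeft e]
    exact (liftsAt_comp_homeomorph (g := fun _ => x) _).2 (hp.liftsAt_const (n + 1) x)
  refine hconst.congr ?_
  rintro ⟨t, s⟩ (hy | hs)
  · exact (hG1 _ hy 1).symm
  · obtain rfl : s = 1 := hs
    exact ((hG2 t 1).trans (H.apply_one t)).symm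

/-- Trivial Serre fibrations have the right lifting property with respect to `∂Iⁿ ⊆ Iⁿ`.  As the
open box is contractible, the upper map of a lifting problem is homotopic to one which is constant
there. -/
theorem IsTrivialFibration.hasCubeLifting (hp : IsTrivialFibration p) : HasCubeLifting p := by
  have hsurj : Function.Surjective p := fun b => by
    obtain ⟨q, hq⟩ := hp.isWeakHomotopyEquiv.bijective_zeroth.2 (Quotient.mk _ b)
    obtain ⟨x, rfl⟩ := Quotient.exists_rep q
    obtain ⟨γ⟩ : Joined (p x) b := Quotient.exact hq
    obtain ⟨G, -, hG⟩ := hp.isSerreFibration 0 (ContinuousMap.const _ x)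
      (⟨fun y => γ y.2, by fun_prop⟩ : C((Fin 0 → I) × I, B)) fun t => γ.source
    exact ⟨G (default, 1), (hG default 1).trans γ.target⟩
  refine ⟨hsurj, ?_⟩
  rintro (_ | n)
  · intro g _ f _
    obtain ⟨x, hx⟩ := hsurj (f default)
    refine ⟨ContinuousMap.const _ x, fun z ⟨i, _⟩ => i.elim0, fun z => ?_⟩
    rw [Subsingleton.elim z default]
    exact hx
  · suffices HasLifting p (cylBoundary (Fin n)) by
      obtain ⟨e⟩ : Nonempty (Fin (n + 1) ≃ Fin n ⊕ Unit) := Finite.card_eq.1 (by simp)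
      rw [← boundary_piCongrLeft e, ← preimage_cylBoundary]
      exact (this.comp_homeomorph _).comp_homeomorph _
    intro g hg
    obtain ⟨r, ht, h0, h1, h2⟩ := exists_boxFlow (Fin n)
    -- `c` contracts the cylinder to a corner.
    let c : C(((Fin n → I) × I) × I, (Fin n → I) × I) :=
      ⟨fun y => (fun i => y.1.1 i * σ y.2, y.1.2 * σ y.2), by fun_prop⟩
    have hc0 : ∀ y, c (y, 0) = y := fun y => by
      refine Prod.ext (funext fun i => ?_) ?_ <;> simp [c]
    -- `w` contracts the restriction of `g` to the open box, and `V` extends this to the top.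
    let w : ((Fin n → I) × I) × I → E := fun y => g (r (c y, 0))
    have hw : Continuous w := (hg.mono subset_union_left).comp_continuous (by fun_prop)
      fun y => h0 _
    have hw0 : ∀ y ∈ openBox (Fin n), w (y, 0) = g y := fun y hy => by
      have : r (y, 0) = y := by
        conv_rhs => rw [← h1 y, h2 y hy]
      simp only [w, hc0, this]
    obtain ⟨V, hV0, hV⟩ := exists_homotopy_extension (Y := E)
      ⟨fun t => g (t, 1), hg.comp_continuous (by fun_prop) fun t => Or.inr rfl⟩
      (w := fun y : (Fin n → I) × I => w ((y.1, 1), y.2)) (by fun_prop)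
      fun t ht => hw0 _ (Or.inr ht)
    obtain ⟨G, hG, hG1, hG2⟩ := exists_glue_cylBoundary hw.continuousOn V
      fun t ht s => (hV t ht s).symm
    have hGg : EqOn (fun y => G (y, 0)) g (cylBoundary (Fin n)) := by
      rintro ⟨t, s⟩ (hy | hs)
      · exact (hG1 _ hy 0).trans (hw0 _ hy)
      · obtain rfl : s = 1 := hs
        exact (hG2 t 0).trans (hV0 t)
    refine LiftsAt.congr (hp.isSerreFibration.liftsAt_cylinder_of_homotopy hG ?_) hGg
    refine hp.liftsAt_cylinder_of_const n (g (r ((fun _ => 0, 0), 0)))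
      (hG.comp (by fun_prop) fun y hy => hy) fun y hy => ?_
    refine (hG1 _ hy 1).trans ?_
    simp [w, c]

end TrivialFibration

/-! ### Maps lifting cubes relative to their boundary are trivial Serre fibrations -/

section Converse

variable {E B : Type*} [TopologicalSpace E] [TopologicalSpace B] {p : C(E, B)}

/-- Path lifting, with prescribed end points of the lift. -/
theorem HasCubeLifting.exists_lift_path (hp : HasCubeLifting p) (γ : C(I, B)) (x y : E)
    (hx : p x = γ 0) (hy : p y = γ 1) : ∃ δ : C(I, E), δ 0 = x ∧ δ 1 = y ∧ ∀ s, p (δ s) = γ s := by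
  obtain ⟨h, h0, h1, -, hh⟩ := hp.exists_lift_cylinder (ι := Fin 0)
    (⟨fun z => γ z.2, by fun_prop⟩ : C((Fin 0 → I) × I, B)) (ContinuousMap.const _ x)
    (ContinuousMap.const _ y) (w := fun _ => x) continuousOn_const (fun _ => hx) (fun _ => hy)
    (fun t ⟨i, _⟩ => i.elim0) (fun t ⟨i, _⟩ => i.elim0) (fun t ⟨i, _⟩ => i.elim0)
  exact ⟨⟨fun s => h (default, s), by fun_prop⟩, h0 _, h1 _, fun s => hh _⟩

theorem continuousOn_eval {Z W Y : Type*} [TopologicalSpace Z] [TopologicalSpace W]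
    [TopologicalSpace Y] [LocallyCompactSpace W] {D : Set Z} {g : Z → C(W, Y)}
    (hg : ContinuousOn g D) :
    ContinuousOn (fun y : Z × W => g y.1 y.2) {y | y.1 ∈ D} := by
  have : ContinuousOn (fun y : Z × W => (g y.1, y.2)) {y | y.1 ∈ D} :=
    (hg.comp continuousOn_fst fun y hy => hy).prodMk continuousOn_snd
  exact (continuous_eval (F := C(W, Y))).comp_continuousOn this

/-- The map induced on path spaces. -/
def pathSpaceMap (p : C(E, B)) : C(C(I, E), C(I, B)) := ⟨p.comp, p.continuous_postcomp⟩

/-- Boundary lifting passes to path spaces, because `∂(Iⁿ × I)` consists of the sides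
`∂Iⁿ × I`, on which a lift is given, and of two ends, on which it is found first. -/
theorem HasCubeLifting.pathSpaceMap (hp : HasCubeLifting p) : HasCubeLifting (pathSpaceMap p) := by
  refine ⟨fun γ => ?_, fun n g hg f hf => ?_⟩
  · obtain ⟨x, hx⟩ := hp.surjective (γ 0)
    obtain ⟨y, hy⟩ := hp.surjective (γ 1)
    obtain ⟨δ, -, -, hδ⟩ := hp.exists_lift_path γ x y hx hy
    exact ⟨δ, ContinuousMap.ext hδ⟩
  have hend : ∀ s : I, ∃ u : C(Fin n → I, E), (∀ t ∈ Cube.boundary (Fin n), u t = g t s) ∧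
      ∀ t, p (u t) = f t s := fun s =>
    hp.hasLifting n (fun t => g t s) ((continuous_eval_const s).comp_continuousOn hg)
      ⟨fun t => f t s, by fun_prop⟩ fun t ht => DFunLike.congr_fun (hf t ht) s
  obtain ⟨u₀, hu₀, hpu₀⟩ := hend 0
  obtain ⟨u₁, hu₁, hpu₁⟩ := hend 1
  obtain ⟨h, -, -, hh, hph⟩ := hp.exists_lift_cylinder
    (⟨fun y => f y.1 y.2, by fun_prop⟩ : C((Fin n → I) × I, B)) u₀ u₁ (w := fun y => g y.1 y.2)
    (continuousOn_eval hg) hpu₀ hpu₁ (fun t ht s => DFunLike.congr_fun (hf t ht) s)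
    (fun t ht => (hu₀ t ht).symm) (fun t ht => (hu₁ t ht).symm)
  exact ⟨h.curry, fun t ht => ContinuousMap.ext fun s => hh t ht s,
    fun t => ContinuousMap.ext fun s => hph (t, s)⟩

/-- Homotopy lifting for cubes reduces to path lifting in spaces of maps out of cubes. -/
theorem HasCubeLifting.isSerreFibration (hp : HasCubeLifting p) : IsSerreFibration p := by
  intro n
  induction n generalizing E B with
  | zero =>
    intro f H hf
    obtain ⟨y, hy⟩ := hp.surjective (H (default, 1))
    obtain ⟨δ, h0, -, h⟩ := hp.exists_lift_path ⟨fun s => H (default, s), by fun_prop⟩ (f default) y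
      (hf _).symm hy
    refine ⟨⟨fun z => δ z.2, by fun_prop⟩, fun t => ?_, fun t s => ?_⟩
    · rw [Subsingleton.elim t default]; exact h0
    · rw [Subsingleton.elim t default]; exact h s
  | succ n ih =>
    intro f H hf
    obtain ⟨e⟩ : Nonempty (Fin (n + 1) ≃ Fin n ⊕ Unit) := Finite.card_eq.1 (by simp)
    let k : (Fin (n + 1) → I) ≃ₜ (Fin n → I) × I :=
      (Homeomorph.piCongrLeft (Y := fun _ => I) e).trans (cylHomeomorph (Fin n))
    obtain ⟨G, hG, hG'⟩ := ih hp.pathSpaceMap (f.comp k.symm).curry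
      (ContinuousMap.curry ⟨fun y => H (k.symm (y.1.1, y.2), y.1.2), by fun_prop⟩)
      fun t => ContinuousMap.ext fun s => hf _
    refine ⟨⟨fun y => G ((k y.1).1, y.2) (k y.1).2, by fun_prop⟩, fun t => ?_, fun t s => ?_⟩
    · refine (DFunLike.congr_fun (hG (k t).1) (k t).2).trans ?_
      simp
    · refine (DFunLike.congr_fun (hG' (k t).1 s) (k t).2).trans ?_
      simp

theorem HasCubeLifting.isTrivialFibration (hp : HasCubeLifting p) : IsTrivialFibration p where
  isSerreFibration := hp.isSerreFibration
  isWeakHomotopyEquiv := by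
    refine ⟨⟨?_, ?_⟩, fun n x => ⟨?_, ?_⟩⟩
    · rintro ⟨a⟩ ⟨b⟩ hab
      obtain ⟨γ⟩ : Joined (p a) (p b) := Quotient.exact hab
      obtain ⟨δ, h0, h1, -⟩ := hp.exists_lift_path γ a b γ.source.symm γ.target.symm
      exact Quotient.sound ⟨⟨δ, h0, h1⟩⟩
    · rintro ⟨b⟩
      obtain ⟨a, rfl⟩ := hp.surjective b
      exact ⟨Quotient.mk _ a, rfl⟩
    · rintro ⟨a⟩ ⟨b⟩ hab
      obtain ⟨H⟩ : GenLoop.Homotopic (genLoopMap p n x a) (genLoopMap p n x b) :=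
        Quotient.exact hab
      obtain ⟨h, h0, h1, hh, -⟩ := hp.exists_lift_cylinder
        (⟨fun y => H (y.2, y.1), by fun_prop⟩ : C((Fin n → I) × I, B)) a.1 b.1 (w := fun _ => x)
        continuousOn_const (fun t => (H.apply_zero t).symm) (fun t => (H.apply_one t).symm)
        (fun t ht s => Eq.symm <| (H.eq_fst s ht).trans (congrArg p (a.2 t ht)))
        (fun t ht => (a.2 t ht).symm) (fun t ht => (b.2 t ht).symm)
      exact Quotient.sound (show GenLoop.Homotopic a b from
        ⟨{ toFun := fun y => h (y.2, y.1)
           continuous_toFun := by fun_prop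
           map_zero_left := h0
           map_one_left := h1
           prop' := fun s t ht => (hh t ht s).trans (a.2 t ht).symm }⟩)
    · rintro ⟨b⟩
      obtain ⟨h, hh, hph⟩ := hp.hasLifting n (fun _ => x) continuousOn_const b.1 fun t ht => (b.2 t ht).symm
      refine ⟨Quotient.mk _ ⟨h, hh⟩, congrArg (Quotient.mk _) ?_⟩
      exact GenLoop.ext _ _ hph

end Converse

/-! ### Families of lifting problems over a cofibrant space -/

section Families

variable {L E : Type v} {B : Type*} [TopologicalSpace L] [TopologicalSpace E] [TopologicalSpace B]
  {ι : Type}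

/-- The pairs of a parameter `l : L` and a solution of the lifting problem over `l`, for a family
of lifting problems of the boundary of a cube parametrized by `L`. -/
def SolutionSpace (p : C(E, B)) (F : C(L × (ι → I), B)) (g : L × (ι → I) → E) : Type v :=
  {z : L × C(ι → I, E) // (∀ t ∈ Cube.boundary ι, z.2 t = g (z.1, t)) ∧
    ∀ t, p (z.2 t) = F (z.1, t)}

variable (p : C(E, B)) (F : C(L × (ι → I), B)) (g : L × (ι → I) → E)

instance : TopologicalSpace (SolutionSpace p F g) := instTopologicalSpaceSubtype

/-- The projection of the solution space to the parameter space. -/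
def solutionParameter : C(SolutionSpace p F g, L) :=
  ⟨fun z => z.1.1, continuous_fst.comp continuous_subtype_val⟩

variable {p F g}

theorem boundary_sum (ι κ : Type*) :
    Homeomorph.sumArrowHomeomorphProdArrow ⁻¹'
      ({y | y.1 ∈ Cube.boundary ι} ∪ {y | y.2 ∈ Cube.boundary κ} : Set ((ι → I) × (κ → I))) =
      Cube.boundary (ι ⊕ κ) := by
  ext y
  constructor
  · rintro (⟨i, h⟩ | ⟨i, h⟩)
    · exact ⟨Sum.inl i, h⟩
    · exact ⟨Sum.inr i, h⟩
  · rintro ⟨i | i, h⟩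
    · exact Or.inl ⟨i, h⟩
    · exact Or.inr ⟨i, h⟩

/-- A lifting problem of `∂Iⁿ ⊆ Iⁿ` against the projection of the solution space amounts to one of
`∂(Iⁿ × I^ι) ⊆ Iⁿ × I^ι` against `p`, as `∂(Iⁿ × I^ι) = ∂Iⁿ × I^ι ∪ Iⁿ × ∂I^ι`. -/
theorem HasCubeLifting.solutionParameter [Finite ι] (hp : HasCubeLifting p)
    (hg : ContinuousOn g {y | y.2 ∈ Cube.boundary ι})
    (hgF : ∀ l, ∀ t ∈ Cube.boundary ι, p (g (l, t)) = F (l, t)) :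
    HasCubeLifting (solutionParameter p F g) := by
  refine ⟨fun l => ?_, fun n k hk f hf => ?_⟩
  · obtain ⟨h, hh, hph⟩ := hp.boundary ι (fun t => g (l, t))
      (hg.comp (by fun_prop) fun t ht => ht) ⟨fun t => F (l, t), by fun_prop⟩ (hgF l)
    exact ⟨⟨(l, h), hh, hph⟩, rfl⟩
  have hk' : ∀ t ∈ Cube.boundary (Fin n), (k t).1.1 = f t := hf
  have hk2 : ContinuousOn (fun t => (k t).1.2) (Cube.boundary (Fin n)) :=
    (continuous_snd.comp continuous_subtype_val).comp_continuousOn hk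
  obtain ⟨w, hw, hwk, hwg⟩ := exists_continuousOn_union
    (A := {y : (Fin n → I) × (ι → I) | y.1 ∈ Cube.boundary (Fin n)})
    (B := {y | y.2 ∈ Cube.boundary ι}) (isClosed_boundary.preimage continuous_fst)
    (isClosed_boundary.preimage continuous_snd) (f := fun y => (k y.1).1.2 y.2)
    (g := fun y => g (f y.1, y.2)) (continuousOn_eval hk2)
    (hg.comp (by fun_prop) fun y hy => hy) (fun y hy hy' => by
      rw [(k y.1).2.1 _ hy', hk' _ hy])
  have hlift := (hp.boundary (Fin n ⊕ ι)).comp_homeomorph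
    Homeomorph.sumArrowHomeomorphProdArrow.symm
  rw [← boundary_sum, ← preimage_comp, Homeomorph.self_comp_symm, preimage_id] at hlift
  obtain ⟨h, hh, hph⟩ := hlift w hw ⟨fun y => F (f y.1, y.2), by fun_prop⟩ (by
    rintro y (hy | hy)
    · rw [hwk hy, (k y.1).2.2, hk' _ hy]; rfl
    · rw [hwg hy]; exact hgF _ _ hy)
  refine ⟨⟨fun t => ⟨(f t, h.curry t), fun s hs => ?_, fun s => hph (t, s)⟩, ?_⟩, fun t ht => ?_,
    fun t => rfl⟩
  · exact (hh (t, s) (Or.inr hs)).trans (hwg hs)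
  · exact Continuous.subtype_mk (by fun_prop) _
  · refine Subtype.ext (Prod.ext (hk' t ht).symm (ContinuousMap.ext fun s => ?_))
    exact (hh (t, s) (Or.inl ht)).trans (hwk ht)

/-- Families of lifting problems over a cofibrant space have continuous families of solutions. -/
theorem HasCubeLifting.exists_family_lift [Finite ι] (hp : HasCubeLifting p)
    (hL : IsSerreCofibrant L) (hg : ContinuousOn g {y | y.2 ∈ Cube.boundary ι})
    (hgF : ∀ l, ∀ t ∈ Cube.boundary ι, p (g (l, t)) = F (l, t)) :
    ∃ h : C(L × (ι → I), E), (∀ l, ∀ t ∈ Cube.boundary ι, h (l, t) = g (l, t)) ∧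
      ∀ y, p (h y) = F y := by
  -- A section of the projection of the solution space is a continuous choice of solutions.
  obtain ⟨s, hs⟩ := hL _ _ _ (hp.solutionParameter hg hgF).isTrivialFibration (ContinuousMap.id L)
  have hs' : ∀ l, (s l).1.1 = l := fun l => DFunLike.congr_fun hs l
  refine ⟨⟨fun y => (s y.1).1.2 y.2, ?_⟩, fun l t ht => ?_, fun y => ?_⟩
  · have : Continuous fun l => (s l).1.2 :=
      (continuous_snd.comp continuous_subtype_val).comp s.continuous
    fun_prop
  · exact ((s l).2.1 t ht).trans (by rw [hs'])
  · exact ((s y.1).2.2 y.2).trans (by rw [hs'])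

end Families

/-! ### Restriction to the axes of a power -/

section Closure

variable {E B C : Type*} [TopologicalSpace E] [TopologicalSpace B] [TopologicalSpace C]

theorem HasCubeLifting.comp {p : C(E, B)} {q : C(B, C)} (hq : HasCubeLifting q)
    (hp : HasCubeLifting p) : HasCubeLifting (q.comp p) where
  surjective := hq.surjective.comp hp.surjective
  hasLifting n g hg f hf := by
    obtain ⟨k, hk, hqk⟩ := hq.hasLifting n (fun t => p (g t)) (p.continuous.comp_continuousOn hg) f hf
    obtain ⟨h, hh, hph⟩ := hp.hasLifting n g hg k fun t ht => (hk t ht).symm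
    exact ⟨h, hh, fun t => (congrArg q (hph t)).trans (hqk t)⟩

theorem hasCubeLifting_homeomorph (e : E ≃ₜ B) : HasCubeLifting (e : C(E, B)) where
  surjective := e.surjective
  hasLifting n g hg f hf :=
    ⟨(e.symm : C(B, E)).comp f, fun t ht => (congrArg e.symm (hf t ht).symm).trans (by simp),
      fun t => by simp⟩

theorem HasCubeLifting.id_prodMap {q : C(B, C)} (hq : HasCubeLifting q) :
    HasCubeLifting ((ContinuousMap.id E).prodMap q) where
  surjective := Function.surjective_id.prodMap hq.surjective
  hasLifting n g hg f hf := by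
    obtain ⟨k, hk, hqk⟩ := hq.hasLifting n (fun t => (g t).2) (continuous_snd.comp_continuousOn hg)
      ⟨fun t => (f t).2, by fun_prop⟩ fun t ht => congrArg Prod.snd (hf t ht)
    exact ⟨⟨fun t => ((f t).1, k t), by fun_prop⟩,
      fun t ht => Prod.ext (congrArg Prod.fst (hf t ht)).symm (hk t ht),
      fun t => Prod.ext rfl (hqk t)⟩

end Closure

section Axes

variable {T : Type u} [Category.{v} T] [TopStarCategory T] [HasFiniteProducts T]

/-- The `m`-fold power of an object. -/
noncomputable abbrev power (A : T) (m : ℕ) : T := ∏ᶜ fun _ : Fin m => A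

/-- The inclusion of the `k`-th axis into a power. -/
noncomputable def axis (A : T) {m : ℕ} (k : Fin m) : A ⟶ power A m := Pi.lift (Pi.single k (𝟙 A))

/-- The restriction of maps out of a power to the axes. -/
noncomputable def axesRestriction (A Z : T) (m : ℕ) : C(power A m ⟶ Z, Fin m → (A ⟶ Z)) where
  toFun f k := axis A k ≫ f
  continuous_toFun := continuous_pi fun k => continuous_precomp (axis A k) Z

/-- Splitting off the first factor of a power. -/
noncomputable def powerSuccIso (A : T) (m : ℕ) : A ⨯ power A m ≅ power A (m + 1) where
  hom := Pi.lift (Fin.cons prod.fst fun i => prod.snd ≫ Pi.π _ i)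
  inv := prod.lift (Pi.π _ 0) (Pi.lift fun i => Pi.π _ i.succ)
  hom_inv_id := by
    ext i
    · simp [prod.comp_lift, prod.lift_fst]
    · simp [prod.comp_lift, prod.lift_snd_assoc]
  inv_hom_id := by
    refine Pi.hom_ext _ _ fun i => ?_
    refine Fin.cases ?_ (fun i => ?_) i <;> simp [prod.lift_fst, prod.lift_snd_assoc]

theorem axis_zero (A : T) (m : ℕ) :
    axis A (0 : Fin (m + 1)) = prod.lift (𝟙 A) 0 ≫ (powerSuccIso A m).hom := by
  refine Pi.hom_ext _ _ fun i => ?_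
  refine Fin.cases ?_ (fun i => ?_) i <;>
    simp [axis, powerSuccIso, prod.lift_fst, prod.lift_snd_assoc]

theorem axis_succ (A : T) {m : ℕ} (k : Fin m) :
    axis A k.succ = axis A k ≫ prod.lift 0 (𝟙 _) ≫ (powerSuccIso A m).hom := by
  refine Pi.hom_ext _ _ fun i => ?_
  refine Fin.cases ?_ (fun i => ?_) i
  · simp [axis, powerSuccIso, prod.lift_fst]
  · simp [axis, powerSuccIso, prod.lift_snd_assoc, Pi.single_apply]

/-- Precomposition with an isomorphism. -/
def precompHomeomorph {A B : T} (i : A ≅ B) (Z : T) : (B ⟶ Z) ≃ₜ (A ⟶ Z) where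
  toFun f := i.hom ≫ f
  invFun f := i.inv ≫ f
  left_inv f := by simp
  right_inv f := by simp
  continuous_toFun := continuous_precomp _ Z
  continuous_invFun := continuous_precomp _ Z

/-- A pair of an element and an `m`-tuple as an `(m + 1)`-tuple. -/
def consHomeomorph (Y : Type*) [TopologicalSpace Y] (m : ℕ) :
    Y × (Fin m → Y) ≃ₜ (Fin (m + 1) → Y) where
  toFun y := Fin.cons y.1 y.2
  invFun y := (y 0, fun i => y i.succ)
  left_inv y := by simp
  right_inv y := by ext i; refine Fin.cases ?_ (fun i => ?_) i <;> simp
  continuous_toFun := continuous_pi fun i => by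
    refine Fin.cases ?_ (fun i => ?_) i <;> simp only [Fin.cons_zero, Fin.cons_succ] <;> fun_prop
  continuous_invFun := by fun_prop

/-- In a weakly bilinear mapping theory, the restriction to the axes of a power is a trivial
fibration.  The empty power is a zero object. -/
theorem hasCubeLifting_axesRestriction
    (hT : ∀ A B Z : T, IsTrivialFibration (restrictionMap A B Z)) (A Z : T) (m : ℕ) :
    HasCubeLifting (axesRestriction A Z m) := by
  induction m with
  | zero =>
    have hzero : ∀ f : power A 0 ⟶ Z, f = 0 := fun f => by
      rw [← Category.id_comp f, show 𝟙 (power A 0) = 0 from Pi.hom_ext _ _ fun i => i.elim0,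
        zero_comp]
    exact ⟨fun y => ⟨0, Subsingleton.elim _ _⟩, fun n g _ f _ =>
      ⟨ContinuousMap.const _ 0, fun t _ => (hzero _).symm, fun t => Subsingleton.elim _ _⟩⟩
  | succ m ih =>
    have h := (hasCubeLifting_homeomorph (consHomeomorph (A ⟶ Z) m)).comp
      ((ih.id_prodMap (E := A ⟶ Z)).comp ((hT A (power A m) Z).hasCubeLifting.comp
        (hasCubeLifting_homeomorph (precompHomeomorph (powerSuccIso A m) Z))))
    convert h using 1
    ext f k
    refine Fin.cases ?_ (fun k => ?_) k
    · exact (congrArg (· ≫ f) (axis_zero A m)).trans (Category.assoc _ _ _)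
    · refine (congrArg (· ≫ f) (axis_succ A k)).trans ?_
      rw [Category.assoc, Category.assoc]
      rfl

end Axes

/-! ### Boundary conditions with sequences as indices -/

section Sequences

/-- The sequence `x_0, …, x_j + x_{j+1}, …`. -/
def contractSeq {M : Type*} [Add M] (j : ℕ) (x : ℕ → M) (i : ℕ) : M :=
  if i < j then x i else if i = j then x i + x (i + 1) else x (i + 1)

/-- The sequence `t_0, …, t_j, …` with `t_j` omitted. -/
def omitSeq {M : Type*} (j : ℕ) (t : ℕ → M) (i : ℕ) : M := if i < j then t i else t (i + 1)

/-- The sequence `x_c, x_{c+1}, …`. -/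
def shiftSeq {M : Type*} (c : ℕ) (x : ℕ → M) (i : ℕ) : M := x (c + i)

/-- A tuple continued by a constant. -/
def extendSeq {M : Type*} {m : ℕ} (d : M) (x : Fin m → M) (i : ℕ) : M :=
  if h : i < m then x ⟨i, h⟩ else d

/-- The sequence `d, x_0, x_1, …`. -/
def consSeq {M : Type*} (d : M) (x : ℕ → M) (i : ℕ) : M := if i = 0 then d else x (i - 1)

theorem extendSeq_coe {M : Type*} {m : ℕ} (d : M) (x : Fin m → M) (i : Fin m) :
    extendSeq d x i = x i := dif_pos i.2

theorem extendSeq_of_lt {M : Type*} {m : ℕ} (d : M) (x : Fin m → M) {i : ℕ} (h : i < m) :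
    extendSeq d x i = x ⟨i, h⟩ := dif_pos h

theorem contractSeq_contractSeq {M : Type*} [AddSemigroup M] {i j : ℕ} (h : i ≤ j) (x : ℕ → M) :
    contractSeq j (contractSeq i x) = contractSeq i (contractSeq (j + 1) x) := by
  funext l
  unfold contractSeq
  split_ifs <;> first | omega | rfl | skip
  rw [add_assoc]

theorem omitSeq_omitSeq {M : Type*} {i j : ℕ} (h : i ≤ j) (t : ℕ → M) :
    omitSeq j (omitSeq i t) = omitSeq i (omitSeq (j + 1) t) := by
  funext l
  unfold omitSeq
  split_ifs <;> first | omega | rfl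

theorem contractNth_eq {M : Type*} [Add M] {m : ℕ} (j : Fin (m + 1)) (x : Fin (m + 2) → M) (d : M)
    (i : Fin (m + 1)) :
    Fin.contractNth j.castSucc (· + ·) x i = contractSeq j (extendSeq d x) i := by
  have h1 : (i : ℕ) < m + 2 := by omega
  have h2 : (i : ℕ) + 1 < m + 2 := by omega
  unfold Fin.contractNth contractSeq
  rw [extendSeq_of_lt d x h1, extendSeq_of_lt d x h2]
  rfl

theorem succAbove_eq {M : Type*} {m : ℕ} (j : Fin (m + 1)) (t : Fin (m + 1) → M) (d : M)
    (i : Fin m) : t (j.succAbove i) = omitSeq j (extendSeq d t) i := by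
  have h1 : (i : ℕ) < m + 1 := by omega
  have h2 : (i : ℕ) + 1 < m + 1 := by omega
  unfold omitSeq
  rw [extendSeq_of_lt d t h1, extendSeq_of_lt d t h2]
  unfold Fin.succAbove
  split_ifs with h h' h'
  · rfl
  · exact absurd h h'
  · exact absurd h' h
  · rfl

end Sequences

namespace Distributor

variable {T : Type u} [Category.{v} T] [TopStarCategory T] [LeftLinear T] {n : ℕ}

/-- The value of a cube of a distributor on sequences of which only the first terms matter.  It is
`0` in dimensions beyond that of the distributor. -/
noncomputable def val (φ : Distributor T n) (m : ℕ) {X A B : T} (a : A ⟶ B) (x : ℕ → (X ⟶ A))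
    (t : ℕ → I) : X ⟶ B :=
  if h : m ≤ n then φ.cube m h a (fun i => x i) (fun i => t i) else 0

variable (φ : Distributor T n) {X A B : T} (a : A ⟶ B)

theorem val_eq {m : ℕ} (hm : m ≤ n) (x : ℕ → (X ⟶ A)) (t : ℕ → I) :
    φ.val m a x t = φ.cube m hm a (fun i => x i) (fun i => t i) := dif_pos hm

theorem cube_eq_val {m : ℕ} (hm : m ≤ n) (x : Fin (m + 1) → (X ⟶ A)) (t : Fin m → I) :
    φ.cube m hm a x t = φ.val m a (extendSeq 0 x) (extendSeq 0 t) := by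
  rw [val_eq φ a hm]
  simp only [extendSeq_coe]

theorem val_congr {m : ℕ} {x x' : ℕ → (X ⟶ A)} {t t' : ℕ → I} (hx : ∀ i ≤ m, x i = x' i)
    (ht : ∀ i < m, t i = t' i) : φ.val m a x t = φ.val m a x' t' := by
  unfold val
  rw [show (fun i : Fin (m + 1) => x i) = fun i : Fin (m + 1) => x' i from
      funext fun i => hx i (by omega),
    show (fun i : Fin m => t i) = fun i : Fin m => t' i from funext fun i => ht i i.2]

theorem val_face_zero {k j : ℕ} (hk : k + 1 ≤ n) (hj : j ≤ k) (x : ℕ → (X ⟶ A)) {t : ℕ → I}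
    (ht : t j = 0) : φ.val (k + 1) a x t = φ.val k a (contractSeq j x) (omitSeq j t) := by
  rw [val_eq φ a hk, φ.cube_face_zero k hk a _ _ ⟨j, by omega⟩ ht, val_eq φ a (by omega)]
  refine congrArg _ (funext fun i => ?_)
  rw [succAbove_eq _ (fun i : Fin (k + 1) => t i) 0]
  have h1 : (i : ℕ) < k + 1 := by omega
  have h2 : (i : ℕ) + 1 < k + 1 := by omega
  simp only [omitSeq, extendSeq_of_lt _ _ h1, extendSeq_of_lt _ _ h2]

theorem val_face_one {p q : ℕ} (hpq : p + q + 1 ≤ n) (x : ℕ → (X ⟶ A)) {t : ℕ → I}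
    (ht : t p = 1) :
    φ.val (p + q + 1) a x t =
      φ.val p a x t + φ.val q a (shiftSeq (p + 1) x) (shiftSeq (p + 1) t) := by
  rw [val_eq φ a hpq, φ.cube_face_one p q hpq a _ _ ht, val_eq φ a (by omega),
    val_eq φ a (by omega)]
  rfl

/-- The face `t_j = 0` of an `(n + 1)`-cube of a distributor based on `φ`. -/
noncomputable def faceZero (j : ℕ) (x : ℕ → (X ⟶ A)) (t : ℕ → I) : X ⟶ B :=
  φ.val n a (contractSeq j x) (omitSeq j t)

/-- The face `t_j = 1` of an `(n + 1)`-cube of a distributor based on `φ`. -/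
noncomputable def faceOne (j : ℕ) (x : ℕ → (X ⟶ A)) (t : ℕ → I) : X ⟶ B :=
  φ.val j a x t + φ.val (n - j) a (shiftSeq (j + 1) x) (shiftSeq (j + 1) t)

variable {a}

/-! The prescribed values on two faces of an `(n + 1)`-cube agree on their intersection: both are
computed by a boundary condition in dimension at most `n`. -/

theorem faceZero_eq_faceZero {i j : ℕ} (hij : i < j) (hj : j ≤ n) (x : ℕ → (X ⟶ A)) {t : ℕ → I}
    (hi : t i = 0) (hj' : t j = 0) : φ.faceZero a i x t = φ.faceZero a j x t := by
  obtain ⟨j, rfl⟩ : ∃ j', j = j' + 1 := ⟨j - 1, by omega⟩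
  obtain ⟨k, rfl⟩ : ∃ k, n = k + 1 := ⟨n - 1, by omega⟩
  unfold faceZero
  rw [val_face_zero φ a le_rfl (j := j) (by omega) _ (by
      unfold omitSeq; rwa [if_neg (by omega)]),
    val_face_zero φ a le_rfl (j := i) (by omega) (contractSeq (j + 1) x) (by
      unfold omitSeq; rwa [if_pos (by omega)]),
    contractSeq_contractSeq (by omega), omitSeq_omitSeq (by omega)]

theorem faceZero_eq_faceOne {i j : ℕ} (hij : i < j) (hj : j ≤ n) (x : ℕ → (X ⟶ A)) {t : ℕ → I}
    (hi : t i = 0) (hj' : t j = 1) : φ.faceZero a i x t = φ.faceOne a j x t := by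
  obtain ⟨j, rfl⟩ : ∃ j', j = j' + 1 := ⟨j - 1, by omega⟩
  obtain ⟨q, rfl⟩ : ∃ q, n = j + q + 1 := ⟨n - j - 1, by omega⟩
  unfold faceZero faceOne
  rw [val_face_one φ a le_rfl (p := j) (q := q) _ (by
      unfold omitSeq; rwa [if_neg (by omega)]),
    val_face_zero φ a (by omega) (j := i) (by omega) x hi,
    show j + q + 1 - (j + 1) = q by omega]
  congr 1
  refine φ.val_congr a (fun l _ => ?_) fun l _ => ?_
  · simp only [shiftSeq, contractSeq]
    rw [if_neg (by omega), if_neg (by omega)]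
    congr 1; omega
  · simp only [shiftSeq, omitSeq]
    rw [if_neg (by omega)]
    congr 1; omega

theorem faceOne_eq_faceZero {i j : ℕ} (hij : i < j) (hj : j ≤ n) (x : ℕ → (X ⟶ A)) {t : ℕ → I}
    (hi : t i = 1) (hj' : t j = 0) : φ.faceOne a i x t = φ.faceZero a j x t := by
  obtain ⟨d, rfl⟩ : ∃ d, j = i + 1 + d := ⟨j - i - 1, by omega⟩
  obtain ⟨q, rfl⟩ : ∃ q, n = i + q + 1 := ⟨n - i - 1, by omega⟩
  unfold faceZero faceOne
  rw [val_face_one φ a le_rfl (p := i) (q := q) _ (by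
      unfold omitSeq; rwa [if_pos (by omega)]),
    show i + q + 1 - i = q + 1 by omega,
    val_face_zero φ a (by omega) (j := d) (by omega) _ hj']
  congr 1
  · refine φ.val_congr a (fun l _ => ?_) fun l _ => ?_
    · unfold contractSeq; rw [if_pos (by omega)]
    · unfold omitSeq; rw [if_pos (by omega)]
  · refine φ.val_congr a (fun l _ => ?_) fun l _ => ?_
    · simp only [shiftSeq, contractSeq]
      split_ifs <;> first | omega | rfl
    · simp only [shiftSeq, omitSeq]
      split_ifs <;> first | omega | rfl

theorem faceOne_eq_faceOne {i j : ℕ} (hij : i < j) (hj : j ≤ n) (x : ℕ → (X ⟶ A)) {t : ℕ → I}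
    (hi : t i = 1) (hj' : t j = 1) : φ.faceOne a i x t = φ.faceOne a j x t := by
  obtain ⟨d, rfl⟩ : ∃ d, j = i + d + 1 := ⟨j - i - 1, by omega⟩
  obtain ⟨q, rfl⟩ : ∃ q, n = i + d + 1 + q := ⟨n - i - d - 1, by omega⟩
  unfold faceOne
  rw [show i + d + 1 + q - i = d + q + 1 by omega,
    show i + d + 1 + q - (i + d + 1) = q by omega,
    val_face_one φ a (by omega) (p := i) (q := d) _ hi,
    val_face_one φ a (by omega) (p := d) (q := q) _ (by
      unfold shiftSeq; rw [← hj']; congr 1; omega), ← add_assoc]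
  congr 1
  refine φ.val_congr a (fun l _ => ?_) fun l _ => ?_ <;>
  · simp only [shiftSeq]
    congr 1; omega

end Distributor

/-! ### Good distributors in all dimensions -/

section Good

variable {T : Type u} [Category.{v} T] [TopStarCategory T]

theorem comp_piLift {T : Type u} [Category.{v} T] [HasFiniteProducts T] {Y X A : T} {m : ℕ} (y : Y ⟶ X) (x : Fin m → (X ⟶ A)) :
    y ≫ Pi.lift x = Pi.lift fun i => y ≫ x i :=
  Pi.hom_ext _ _ fun i => by simp

theorem comp_add [LeftLinear T] {Y X A : T} (y : Y ⟶ X) (x x' : X ⟶ A) :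
    y ≫ (x + x') = y ≫ x + y ≫ x' := LeftLinear.comp_add y x x'

/-- Composition is additive in its left factor, so merging two entries commutes with
precomposition. -/
theorem comp_contractSeq [LeftLinear T] {Y X A : T} (y : Y ⟶ X) (j : ℕ) (x : ℕ → (X ⟶ A)) :
    (fun i => y ≫ contractSeq j x i) = contractSeq j fun i => y ≫ x i := by
  funext i
  unfold contractSeq
  split_ifs <;> first | rfl | exact comp_add _ _ _

theorem contractSeq_single {M : Type*} [AddMonoid M] (j k : ℕ) (x : M) :
    contractSeq j (Pi.single k x : ℕ → M) = Pi.single (if k ≤ j then k else k - 1) x := by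
  funext i
  simp only [contractSeq, Pi.single_apply]
  split_ifs <;> first | omega | simp

/-- The projections of a power, continued by zero. -/
noncomputable def projSeq [HasFiniteProducts T] (A : T) (m : ℕ) : ℕ → (power A m ⟶ A) :=
  extendSeq 0 (Pi.π fun _ : Fin m => A)

theorem axis_comp_projSeq [LeftLinear T] [HasFiniteProducts T] (A : T) {m : ℕ} (k : Fin m) :
    (fun i => axis A k ≫ projSeq A m i) = Pi.single (k : ℕ) (𝟙 A) := by
  funext i
  unfold projSeq extendSeq axis
  split_ifs with h
  · simp only [limit.lift_π, Fan.mk_π_app, Pi.single_apply, Fin.ext_iff]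
  · rw [comp_zero, Pi.single_apply, if_neg (by omega)]

theorem lift_comp_projSeq [HasFiniteProducts T] {X A : T} {m : ℕ} (x : Fin m → (X ⟶ A)) :
    (fun i => Pi.lift x ≫ projSeq A m i) = extendSeq 0 x := by
  funext i
  unfold projSeq extendSeq
  split_ifs with h
  · simp
  · simp

theorem piLift_π {T : Type u} [Category.{v} T] [HasFiniteProducts T] (A : T) (m : ℕ) :
    Pi.lift (Pi.π fun _ : Fin m => A) = 𝟙 (power A m) :=
  Pi.hom_ext _ _ fun i => by simp

theorem piLift_single [HasFiniteProducts T] {X A : T} {m : ℕ} (k : Fin m) (x : X ⟶ A) :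
    (Pi.lift (Pi.single k x) : X ⟶ power A m) = x ≫ axis A k := by
  refine Pi.hom_ext _ _ fun i => ?_
  simp only [axis, limit.lift_π, Fan.mk_π_app, Category.assoc, Pi.single_apply]
  split_ifs
  · exact (Category.comp_id x).symm
  · exact comp_zero.symm

namespace Distributor

variable [LeftLinear T] {n : ℕ} {φ : Distributor T n}

/-- Lower cubes of a distributor are faces of higher ones, which is why goodness, a condition on
the top dimension only, is inherited by all dimensions. -/
theorem val_eq_val_succ (φ : Distributor T n) {X A B : T} {m : ℕ} (hm : m + 1 ≤ n) (a : A ⟶ B)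
    (x : ℕ → (X ⟶ A)) (t : ℕ → I) :
    φ.val m a x t = φ.val (m + 1) a (consSeq 0 x) (consSeq 0 t) := by
  rw [val_face_zero φ a hm (j := 0) (Nat.zero_le _) _ (by simp [consSeq])]
  refine φ.val_congr a (fun i _ => ?_) fun i _ => ?_
  · rcases i with _ | i
    · simp only [contractSeq, consSeq]
      exact (zero_add _).symm
    · simp [contractSeq, consSeq]
  · simp [omitSeq, consSeq]

variable [MappingTheory T]

/-- Universality amounts to naturality in the source of the tuple. -/
theorem IsGood.comp_top (hφ : φ.IsGood) {Y X A B : T} (y : Y ⟶ X) (a : A ⟶ B)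
    (x : Fin (n + 1) → (X ⟶ A)) (t : Fin n → I) :
    y ≫ φ.top a x t = φ.top a (fun i => y ≫ x i) t := by
  rw [hφ.universality a x, hφ.universality a fun i => y ≫ x i, ← comp_piLift, Category.assoc]

/-- The cubes of a good distributor are natural in all dimensions. -/
theorem IsGood.comp_val (hφ : φ.IsGood) {m : ℕ} (hm : m ≤ n) {Y X A B : T} (y : Y ⟶ X)
    (a : A ⟶ B) (x : ℕ → (X ⟶ A)) (t : ℕ → I) :
    y ≫ φ.val m a x t = φ.val m a (fun i => y ≫ x i) t := by
  obtain ⟨d, hd⟩ := Nat.exists_eq_add_of_le hm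
  induction d generalizing m x t with
  | zero =>
    obtain rfl : m = n := hd.symm
    rw [val_eq φ a le_rfl, val_eq φ a le_rfl]
    exact hφ.comp_top y a _ _
  | succ d ih =>
    rw [φ.val_eq_val_succ (by omega), ih (by omega) _ _ (by omega),
      φ.val_eq_val_succ (by omega) a fun i => y ≫ x i]
    congr 1
    funext i
    unfold consSeq
    split_ifs
    · exact comp_zero
    · rfl

/-- The cubes of a good distributor on the axes are constant in all dimensions. -/
theorem IsGood.val_single (hφ : φ.IsGood) {m k : ℕ} (hm : m ≤ n) (hk : k ≤ m) {X A B : T}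
    (a : A ⟶ B) (x : X ⟶ A) (t : ℕ → I) : φ.val m a (Pi.single k x) t = x ≫ a := by
  obtain ⟨d, hd⟩ := Nat.exists_eq_add_of_le hm
  induction d generalizing m k t with
  | zero =>
    obtain rfl : m = n := hd.symm
    rw [val_eq φ a le_rfl, ← hφ.wedge a x ⟨k, by omega⟩ fun i => t i]
    refine congrArg (fun z => φ.top a z fun i => t i) (funext fun i => ?_)
    simp only [Pi.single_apply, Fin.ext_iff]
  | succ d ih =>
    rw [φ.val_eq_val_succ (by omega), ← ih (m := m + 1) (k := k + 1) (by omega) (by omega) (consSeq 0 t)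
      (by omega)]
    refine φ.val_congr a (fun i _ => ?_) fun _ _ => rfl
    rcases i with _ | i
    · simp [consSeq]
    · simp [consSeq, Pi.single_apply]

theorem IsGood.val_zero (hφ : φ.IsGood) {m : ℕ} (hm : m ≤ n) {X A B : T} (a : A ⟶ B)
    {x : ℕ → (X ⟶ A)} (hx : ∀ i ≤ m, x i = 0) (t : ℕ → I) : φ.val m a x t = 0 := by
  rw [← zero_comp (X := X) (f := a), ← hφ.val_single hm (Nat.zero_le m) a 0 t]
  refine φ.val_congr a (fun i hi => ?_) fun _ _ => rfl
  rw [hx i hi, Pi.single_apply, ite_self]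

theorem IsGood.comp_faceZero (hφ : φ.IsGood) {Y X A B : T} (y : Y ⟶ X) (a : A ⟶ B) (j : ℕ)
    (x : ℕ → (X ⟶ A)) (t : ℕ → I) :
    y ≫ φ.faceZero a j x t = φ.faceZero a j (fun i => y ≫ x i) t := by
  unfold faceZero
  rw [hφ.comp_val le_rfl, comp_contractSeq]

theorem IsGood.comp_faceOne (hφ : φ.IsGood) {Y X A B : T} (y : Y ⟶ X) (a : A ⟶ B) {j : ℕ}
    (hj : j ≤ n) (x : ℕ → (X ⟶ A)) (t : ℕ → I) :
    y ≫ φ.faceOne a j x t = φ.faceOne a j (fun i => y ≫ x i) t := by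
  unfold faceOne
  rw [comp_add, hφ.comp_val hj, hφ.comp_val (Nat.sub_le _ _)]
  rfl

theorem IsGood.faceZero_single (hφ : φ.IsGood) {X A B : T} (a : A ⟶ B) {j k : ℕ} (hj : j ≤ n)
    (hk : k ≤ n + 1) (x : X ⟶ A) (t : ℕ → I) : φ.faceZero a j (Pi.single k x) t = x ≫ a := by
  unfold faceZero
  have := contractSeq_single j k x
  refine (φ.val_congr a (fun i _ => congrFun this i) fun _ _ => rfl).trans ?_
  exact hφ.val_single le_rfl (by split_ifs <;> omega) a x _

theorem IsGood.faceOne_single (hφ : φ.IsGood) {X A B : T} (a : A ⟶ B) {j k : ℕ} (hj : j ≤ n)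
    (hk : k ≤ n + 1) (x : X ⟶ A) (t : ℕ → I) : φ.faceOne a j (Pi.single k x) t = x ≫ a := by
  unfold faceOne
  by_cases h : k ≤ j
  · rw [hφ.val_single hj h, hφ.val_zero (Nat.sub_le _ _) a fun i _ => ?_]
    · exact add_zero _
    · simp only [shiftSeq]
      rw [Pi.single_apply, if_neg (by omega)]
  · rw [hφ.val_zero hj a fun i _ => ?_]
    · refine (zero_add _).trans ?_
      rw [← hφ.val_single (m := n - j) (k := k - j - 1) (Nat.sub_le _ _) (by omega) a x
        (shiftSeq (j + 1) t)]
      refine φ.val_congr a (fun i _ => ?_) fun _ _ => rfl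
      simp only [shiftSeq, Pi.single_apply]
      congr 1
      exact propext (by omega)
    · rw [Pi.single_apply, if_neg (by omega)]

end Distributor

end Good

/-! ### Continuity of the faces -/

section Continuity

variable {T : Type u} [Category.{v} T] [TopStarCategory T]

theorem KContinuous.comp_continuous {K Y : Type v} {Z : Type*} [TopologicalSpace K] [CompactSpace K]
    [T2Space K] [TopologicalSpace Y] [TopologicalSpace Z] {g : Y → Z} (hg : KContinuous g)
    {f : K → Y} (hf : Continuous f) : Continuous fun k => g (f k) :=
  hg (i := CompHaus.of K) ⟨f, hf⟩

/-- A map out of the product of a compactly generated space and a compact space is continuous if it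
is so on compact spaces over the first factor. -/
theorem continuous_prod_of_compact {L : Type v} {W : Type} {Z : Type*} [TopologicalSpace L]
    [IsKSpace L] [TopologicalSpace W] [CompactSpace W] [T2Space W] [TopologicalSpace Z]
    {g : L × W → Z}
    (hg : ∀ (K : CompHaus.{v}) (f : C(K, L)), Continuous fun y : K × W => g (f y.1, y.2)) :
    Continuous g := by
  have h1 : ∀ l, Continuous fun w => g (l, w) := fun l =>
    (hg (CompHaus.of PUnit) (ContinuousMap.const _ l)).comp
      (by fun_prop : Continuous fun w : W => ((PUnit.unit : CompHaus.of PUnit.{v + 1}), w))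
  have h2 : Continuous fun l => (⟨fun w => g (l, w), h1 l⟩ : C(W, Z)) := by
    rw [Topology.IsGeneratedBy.continuous_iff (X := compHausFamily.{v})]
    exact fun K f => ContinuousMap.continuous_of_continuous_uncurry _ (hg K f)
  exact (continuous_eval (F := C(W, Z))).comp (h2.prodMap continuous_id)

theorem continuous_comp_of_compact {K : Type v} [TopologicalSpace K] [CompactSpace K] [T2Space K]
    {A B C : T} {f : K → (A ⟶ B)} {g : K → (B ⟶ C)} (hf : Continuous f) (hg : Continuous g) :
    Continuous fun k => f k ≫ g k :=
  KContinuous.comp_continuous (TopStarCategory.continuous_comp A B C) (hg.prodMk hf)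

theorem continuous_lift_of_compact [MappingTheory T] {K : Type v} [TopologicalSpace K]
    [CompactSpace K] [T2Space K] {X A : T} {m : ℕ} {x : K → Fin m → (X ⟶ A)} (hx : Continuous x) :
    Continuous fun k => (Pi.lift (x k) : X ⟶ power A m) :=
  KContinuous.comp_continuous (MappingTheory.continuous_lift m (fun _ => A) X) hx

variable [LeftLinear T] {W : Type} [TopologicalSpace W]

theorem continuous_add_of_compact [CompactSpace W] [T2Space W] {X A B : T} {f g : (A ⟶ B) × W → (X ⟶ B)} (hf : Continuous f)
    (hg : Continuous g) : Continuous fun y => f y + g y :=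
  continuous_prod_of_compact fun K h =>
    KContinuous.comp_continuous (LeftLinear.continuous_add X B)
      (f := fun y : K × W => (f (h y.1, y.2), g (h y.1, y.2))) (by fun_prop)

namespace Distributor

variable {n : ℕ} (φ : Distributor T n)

theorem continuous_val (m : ℕ) {X A B : T} (x : ℕ → (X ⟶ A)) {τ : W → ℕ → I}
    (hτ : ∀ i, Continuous fun w => τ w i) :
    Continuous fun y : (A ⟶ B) × W => φ.val m y.1 x (τ y.2) := by
  by_cases hm : m ≤ n
  · have h : Continuous fun a : A ⟶ B => φ.cube m hm a fun i : Fin (m + 1) => x i := by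
      rw [Topology.IsGeneratedBy.continuous_iff (X := compHausFamily.{v})]
      exact fun K f => φ.continuous_cube m hm X A B
        ⟨fun k => (f k, fun i : Fin (m + 1) => x i), by fun_prop⟩
    simp only [val_eq φ _ hm]
    fun_prop
  · simp only [val, dif_neg hm]
    exact continuous_const

theorem continuous_extendSeq {m : ℕ} (i : ℕ) :
    Continuous fun t : Fin m → I => extendSeq 0 t i := by
  unfold extendSeq
  split_ifs <;> fun_prop

theorem continuous_faceZero (j : ℕ) {X A B : T} (x : ℕ → (X ⟶ A)) (m : ℕ) :
    Continuous fun y : (A ⟶ B) × (Fin m → I) => φ.faceZero y.1 j x (extendSeq 0 y.2) :=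
  φ.continuous_val n (contractSeq j x) (τ := fun t => omitSeq j (extendSeq 0 t)) fun i => by
    unfold omitSeq
    split_ifs <;> exact continuous_extendSeq _

theorem continuous_faceOne (j : ℕ) {X A B : T} (x : ℕ → (X ⟶ A)) (m : ℕ) :
    Continuous fun y : (A ⟶ B) × (Fin m → I) => φ.faceOne y.1 j x (extendSeq 0 y.2) :=
  continuous_add_of_compact (φ.continuous_val j _ continuous_extendSeq)
    (φ.continuous_val (n - j) (shiftSeq (j + 1) x)
      (τ := fun t => shiftSeq (j + 1) (extendSeq 0 t)) fun i => continuous_extendSeq (j + 1 + i))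

end Distributor

end Continuity

/-! ### Distributors from their top-dimensional universal cubes -/

section Extension

variable {T : Type u} [Category.{v} T] [TopStarCategory T] [LeftLinear T] {n : ℕ}

namespace Distributor

/-- A distributor together with a compatible collection of cubes one dimension higher.  The boundary
conditions on the new cubes `c` involve the cubes of `φ` only. -/
noncomputable def extend (φ : Distributor T n) (c : CubeFamily T (n + 1))
    (h0 : ∀ ⦃X A B : T⦄ (a : A ⟶ B) (x : Fin (n + 1 + 1) → (X ⟶ A)) (t : Fin (n + 1) → I)
      (j : Fin (n + 1)), t j = 0 → c a x t = φ.faceZero a j (extendSeq 0 x) (extendSeq 0 t))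
    (h1 : ∀ ⦃X A B : T⦄ (a : A ⟶ B) (x : Fin (n + 1 + 1) → (X ⟶ A)) (t : Fin (n + 1) → I)
      (j : Fin (n + 1)), t j = 1 → c a x t = φ.faceOne a j (extendSeq 0 x) (extendSeq 0 t))
    (hc : ∀ X A B : T, KContinuous fun y : (A ⟶ B) × (Fin (n + 1 + 1) → (X ⟶ A)) => c y.1 y.2) :
    Distributor T (n + 1) where
  cube m hm := if h : m ≤ n then φ.cube m h else (show n + 1 = m by omega) ▸ c
  cube_zero X A B a x t := by
    rw [dif_pos (Nat.zero_le n)]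
    exact φ.cube_zero a x t
  cube_face_zero k hk X A B a x t j hj := by
    rw [dif_pos (show k ≤ n by omega)]
    by_cases h : k + 1 ≤ n
    · rw [dif_pos h]
      exact φ.cube_face_zero k h a x t j hj
    · obtain rfl : k = n := by omega
      rw [dif_neg h]
      refine (h0 a x t j hj).trans ?_
      unfold faceZero
      rw [val_eq φ a le_rfl]
      congr 1
      · exact congrArg _ (funext fun i => (contractNth_eq j x 0 i).symm)
      · exact funext fun i => (succAbove_eq j t 0 i).symm
  cube_face_one p q hpq X A B a x t ht := by
    rw [dif_pos (show p ≤ n by omega), dif_pos (show q ≤ n by omega)]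
    by_cases h : p + q + 1 ≤ n
    · rw [dif_pos h]
      exact φ.cube_face_one p q h a x t ht
    · obtain rfl : n = p + q := by omega
      rw [dif_neg h]
      refine (h1 a x t ⟨p, by omega⟩ ht).trans ?_
      unfold faceOne
      simp only [Nat.add_sub_cancel_left]
      rw [val_eq φ a (by omega), val_eq φ a (by omega)]
      have hx : ∀ i (hi : i < p + q + 1 + 1), extendSeq 0 x i = x ⟨i, hi⟩ := fun i hi =>
        extendSeq_of_lt _ _ hi
      have ht : ∀ i (hi : i < p + q + 1), extendSeq 0 t i = t ⟨i, hi⟩ := fun i hi =>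
        extendSeq_of_lt _ _ hi
      congr 1
      · congr 1
        · exact congrArg _ (funext fun i => hx _ (by omega))
        · exact funext fun i => ht _ (by omega)
      · congr 1
        · exact congrArg _ (funext fun i => hx _ (by omega))
        · exact funext fun i => ht _ (by omega)
  continuous_cube m hm X A B := by
    by_cases h : m ≤ n
    · simp only [dif_pos h]
      exact φ.continuous_cube m h X A B
    · obtain rfl : m = n + 1 := by omega
      simp only [dif_neg h]
      exact hc X A B

theorem IsBasedOn.val_eq_val {φ : Distributor T n} {ψ : Distributor T (n + 1)}
    (h : ψ.IsBasedOn φ) {m : ℕ} (hm : m ≤ n) {X A B : T} (a : A ⟶ B) (x : ℕ → (X ⟶ A))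
    (t : ℕ → I) : ψ.val m a x t = φ.val m a x t := by
  rw [val_eq φ a hm, val_eq ψ a (hm.trans n.le_succ), h m hm]

theorem IsBasedOn.top_eq_faceZero {φ : Distributor T n} {ψ : Distributor T (n + 1)}
    (h : ψ.IsBasedOn φ) {X A B : T} (a : A ⟶ B) (x : Fin (n + 1 + 1) → (X ⟶ A))
    (t : Fin (n + 1) → I) (j : Fin (n + 1)) (hj : t j = 0) :
    ψ.top a x t = φ.faceZero a j (extendSeq 0 x) (extendSeq 0 t) := by
  refine (cube_eq_val ψ a le_rfl x t).trans ?_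
  rw [val_face_zero ψ a le_rfl (j := j) (by omega) _ (by rwa [extendSeq_coe]),
    h.val_eq_val le_rfl]
  rfl

theorem IsBasedOn.top_eq_faceOne {φ : Distributor T n} {ψ : Distributor T (n + 1)}
    (h : ψ.IsBasedOn φ) {X A B : T} (a : A ⟶ B) (x : Fin (n + 1 + 1) → (X ⟶ A))
    (t : Fin (n + 1) → I) (j : Fin (n + 1)) (hj : t j = 1) :
    ψ.top a x t = φ.faceOne a j (extendSeq 0 x) (extendSeq 0 t) := by
  refine (cube_eq_val ψ a le_rfl x t).trans ?_
  obtain ⟨j, hjn⟩ := j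
  obtain ⟨q, rfl⟩ := Nat.exists_eq_add_of_le (Nat.le_of_lt_succ hjn)
  rw [val_face_one ψ a le_rfl (p := j) (q := q) _ (by rwa [extendSeq_of_lt _ _ hjn]),
    h.val_eq_val (by omega), h.val_eq_val (by omega)]
  unfold faceOne
  rw [Nat.add_sub_cancel_left]

theorem IsBasedOn.top_eq_top {φ : Distributor T n} {ψ ψ' : Distributor T (n + 1)}
    (h : ψ.IsBasedOn φ) (h' : ψ'.IsBasedOn φ) {X A B : T} (a : A ⟶ B)
    (x : Fin (n + 1 + 1) → (X ⟶ A)) {t : Fin (n + 1) → I} (ht : t ∈ Cube.boundary (Fin (n + 1))) :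
    ψ.top a x t = ψ'.top a x t := by
  obtain ⟨j, hj | hj⟩ := ht
  · rw [h.top_eq_faceZero a x t j hj, h'.top_eq_faceZero a x t j hj]
  · rw [h.top_eq_faceOne a x t j hj, h'.top_eq_faceOne a x t j hj]

end Distributor

section

variable [MappingTheory T]

/-- The natural collection of cubes with given universal cubes. -/
noncomputable def naturalFamily {m : ℕ}
    (h : ∀ A B : T, C((A ⟶ B) × (Fin m → I), power A (m + 1) ⟶ B)) : CubeFamily T m :=
  fun _ A B a x => ⟨fun t => Pi.lift x ≫ h A B (a, t),
    (continuous_precomp _ B).comp (by fun_prop)⟩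

/-- Universal cubes with the right faces and the right restrictions to the axes determine a good
distributor. -/
theorem Distributor.IsGood.exists_extension {φ : Distributor T n} (hφ : φ.IsGood)
    (h : ∀ A B : T, C((A ⟶ B) × (Fin (n + 1) → I), power A (n + 1 + 1) ⟶ B))
    (h0 : ∀ (A B : T) (a : A ⟶ B) (t : Fin (n + 1) → I) (j : Fin (n + 1)), t j = 0 →
      h A B (a, t) = φ.faceZero a j (projSeq A (n + 1 + 1)) (extendSeq 0 t))
    (h1 : ∀ (A B : T) (a : A ⟶ B) (t : Fin (n + 1) → I) (j : Fin (n + 1)), t j = 1 →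
      h A B (a, t) = φ.faceOne a j (projSeq A (n + 1 + 1)) (extendSeq 0 t))
    (hax : ∀ (A B : T) (a : A ⟶ B) (t : Fin (n + 1) → I) (k : Fin (n + 1 + 1)),
      axis A k ≫ h A B (a, t) = a) :
    ∃ θ : Distributor T (n + 1), θ.IsGood ∧ θ.IsBasedOn φ ∧ θ.top = naturalFamily h := by
  let θ := φ.extend (naturalFamily h)
    (fun X A B a x t j hj => by
      refine (congrArg (Pi.lift x ≫ ·) (h0 A B a t j hj)).trans ?_
      exact (hφ.comp_faceZero _ _ _ _ _).trans (by rw [lift_comp_projSeq]))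
    (fun X A B a x t j hj => by
      refine (congrArg (Pi.lift x ≫ ·) (h1 A B a t j hj)).trans ?_
      exact (hφ.comp_faceOne _ _ (by omega) _ _).trans (by rw [lift_comp_projSeq]))
    (fun X A B K f => by
      refine ContinuousMap.continuous_of_continuous_uncurry _ ?_
      exact continuous_comp_of_compact (K := K × (Fin (n + 1) → I))
        (f := fun y => Pi.lift (f y.1).2) (g := fun y => h A B ((f y.1).1, y.2))
        (continuous_lift_of_compact (by fun_prop)) (by fun_prop))
  have htop : θ.top = naturalFamily h := dif_neg (by omega)
  refine ⟨θ, ⟨fun X A B a x t => ?_, fun X A B a x k t => ?_⟩, fun m hm => dif_pos hm, htop⟩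
  · rw [htop]
    change Pi.lift x ≫ h A B (a, t) = Pi.lift x ≫ Pi.lift _ ≫ h A B (a, t)
    rw [piLift_π, Category.id_comp]
  · rw [htop]
    change Pi.lift (Pi.single k x) ≫ h A B (a, t) = x ≫ a
    rw [piLift_single, Category.assoc, hax]

/-- The universal cubes of a distributor. -/
noncomputable def Distributor.universalCube (ψ : Distributor T n) (A B : T) :
    C((A ⟶ B) × (Fin n → I), power A (n + 1) ⟶ B) where
  toFun y := ψ.top y.1 (Pi.π fun _ => A) y.2
  continuous_toFun := by
    have h : Continuous fun a : A ⟶ B => ψ.top a (Pi.π fun _ : Fin (n + 1) => A) := by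
      rw [Topology.IsGeneratedBy.continuous_iff (X := compHausFamily.{v})]
      exact fun K f => ψ.continuous_cube n le_rfl _ A B
        ⟨fun k => (f k, Pi.π fun _ : Fin (n + 1) => A), by fun_prop⟩
    fun_prop

theorem Distributor.IsGood.axis_comp_universalCube {ψ : Distributor T n} (hψ : ψ.IsGood) {A B : T}
    (a : A ⟶ B) (t : Fin n → I) (k : Fin (n + 1)) : axis A k ≫ ψ.universalCube A B (a, t) = a := by
  refine Eq.trans ?_ (Category.id_comp a)
  rw [← hψ.wedge a (𝟙 A) k t, hψ.universality]
  rfl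

end

end Extension

/-! ### Existence and uniqueness of good distributors -/

section Result

variable {T : Type u} [Category.{v} T] [TopStarCategory T] [LeftLinear T] {n : ℕ}

/-- The prescribed boundary of the universal cubes of a good distributor based on `φ`. -/
theorem Distributor.exists_boundary (φ : Distributor T n) {X A B : T} (x : ℕ → (X ⟶ A)) :
    ∃ g : (A ⟶ B) × (Fin (n + 1) → I) → (X ⟶ B),
      ContinuousOn g {y | y.2 ∈ Cube.boundary (Fin (n + 1))} ∧
      ∀ (a : A ⟶ B) (t : Fin (n + 1) → I) (j : Fin (n + 1)),
        (t j = 0 → g (a, t) = φ.faceZero a j x (extendSeq 0 t)) ∧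
        (t j = 1 → g (a, t) = φ.faceOne a j x (extendSeq 0 t)) := by
  let C : Fin (n + 1) × Bool → Set ((A ⟶ B) × (Fin (n + 1) → I)) := fun i =>
    {y | y.2 i.1 = if i.2 then 1 else 0}
  let G : Fin (n + 1) × Bool → (A ⟶ B) × (Fin (n + 1) → I) → (X ⟶ B) := fun i y =>
    if i.2 then φ.faceOne y.1 i.1 x (extendSeq 0 y.2) else φ.faceZero y.1 i.1 x (extendSeq 0 y.2)
  have hC : ∀ i, IsClosed (C i) := fun i => isClosed_eq (by fun_prop) continuous_const
  have hG : ∀ i, Continuous (G i) := fun ⟨j, ε⟩ => by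
    cases ε
    · exact φ.continuous_faceZero j x _
    · exact φ.continuous_faceOne j x _
  -- Two faces `t_i = ε` and `t_j = ε'` with `i < j`.
  have key : ∀ (i j : Fin (n + 1)) (ε ε' : Bool), i < j →
      ∀ y ∈ C (i, ε), y ∈ C (j, ε') → G (i, ε) y = G (j, ε') y := by
    rintro i j ε ε' hij ⟨a, t⟩ hi hj
    replace hi : extendSeq 0 t i = if ε then 1 else 0 := (extendSeq_coe 0 t i).trans hi
    replace hj : extendSeq 0 t j = if ε' then 1 else 0 := (extendSeq_coe 0 t j).trans hj
    have hij' : (i : ℕ) < j := hij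
    have hjn : (j : ℕ) ≤ n := by omega
    cases ε <;> cases ε'
    · exact φ.faceZero_eq_faceZero hij' hjn x hi hj
    · exact φ.faceZero_eq_faceOne hij' hjn x hi hj
    · exact φ.faceOne_eq_faceZero hij' hjn x hi hj
    · exact φ.faceOne_eq_faceOne hij' hjn x hi hj
  obtain ⟨g, hg, hgG⟩ := exists_continuousOn_iUnion hC G (fun i => (hG i).continuousOn) (by
    rintro ⟨i, ε⟩ ⟨j, ε'⟩ y hi hj
    rcases lt_trichotomy i j with h | rfl | h
    · exact key i j ε ε' h y hi hj
    · have : (if ε then 1 else 0 : I) = if ε' then 1 else 0 := hi.symm.trans hj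
      cases ε <;> cases ε' <;> simp_all
    · exact (key j i ε' ε h y hj hi).symm)
  refine ⟨g, hg.mono ?_, fun a t j => ⟨fun h => ?_, fun h => ?_⟩⟩
  · rintro y ⟨j, hj | hj⟩
    · exact mem_iUnion.2 ⟨(j, false), hj⟩
    · exact mem_iUnion.2 ⟨(j, true), hj⟩
  · exact hgG (j, false) (show (a, t) ∈ C (j, false) from h)
  · exact hgG (j, true) (show (a, t) ∈ C (j, true) from h)

variable [MappingTheory T]

/-- The lifting problem for the universal cubes: on `∂I^{n+1}` they are prescribed by `φ`, and on the
axes they are constant. -/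
theorem exists_good_distributor (hT : IsWeaklyBilinear T)
    (hcof : ∀ A B : T, IsSerreCofibrant (A ⟶ B)) (φ : Distributor T n) (hφ : φ.IsGood) :
    ∃ ψ : Distributor T (n + 1), ψ.IsGood ∧ ψ.IsBasedOn φ := by
  have hex : ∀ A B : T, ∃ h : C((A ⟶ B) × (Fin (n + 1) → I), power A (n + 1 + 1) ⟶ B),
      (∀ (a : A ⟶ B) (t : Fin (n + 1) → I) (j : Fin (n + 1)),
        (t j = 0 → h (a, t) = φ.faceZero a j (projSeq A (n + 1 + 1)) (extendSeq 0 t)) ∧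
        (t j = 1 → h (a, t) = φ.faceOne a j (projSeq A (n + 1 + 1)) (extendSeq 0 t))) ∧
      ∀ (a : A ⟶ B) (t : Fin (n + 1) → I) (k : Fin (n + 1 + 1)), axis A k ≫ h (a, t) = a := by
    intro A B
    obtain ⟨g, hg, hgf⟩ := φ.exists_boundary (B := B) (projSeq A (n + 1 + 1))
    obtain ⟨h, hh, hax⟩ := (hasCubeLifting_axesRestriction hT A B (n + 1 + 1)).exists_family_lift
      (F := ⟨fun y _ => y.1, by fun_prop⟩) (hcof A B) hg (by
        rintro a t ⟨j, hj | hj⟩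
        · refine funext fun k => (congrArg (axis A k ≫ ·) ((hgf a t j).1 hj)).trans ?_
          refine (hφ.comp_faceZero _ _ _ _ _).trans ?_
          rw [axis_comp_projSeq, hφ.faceZero_single a (by omega) (by omega)]
          exact Category.id_comp a
        · refine funext fun k => (congrArg (axis A k ≫ ·) ((hgf a t j).2 hj)).trans ?_
          refine (hφ.comp_faceOne _ _ (by omega) _ _).trans ?_
          rw [axis_comp_projSeq, hφ.faceOne_single a (by omega) (by omega)]
          exact Category.id_comp a)
    exact ⟨h, fun a t j => ⟨fun hj => (hh a t ⟨j, Or.inl hj⟩).trans ((hgf a t j).1 hj),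
      fun hj => (hh a t ⟨j, Or.inr hj⟩).trans ((hgf a t j).2 hj)⟩,
      fun a t k => congrFun (hax (a, t)) k⟩
  choose h hface hax using hex
  obtain ⟨θ, hθ, hθφ, -⟩ := hφ.exists_extension h (fun A B a t j => (hface A B a t j).1)
    (fun A B a t j => (hface A B a t j).2) hax
  exact ⟨θ, hθ, hθφ⟩

/-- The lifting problem for a homotopy of universal cubes, on `∂(I^{n+1} × I)`. -/
theorem exists_good_homotopy (hT : IsWeaklyBilinear T)
    (hcof : ∀ A B : T, IsSerreCofibrant (A ⟶ B)) {φ : Distributor T n} (hφ : φ.IsGood)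
    {ψ ψ' : Distributor T (n + 1)} (hψ : ψ.IsGood) (hψφ : ψ.IsBasedOn φ) (hψ' : ψ'.IsGood)
    (hψφ' : ψ'.IsBasedOn φ) :
    ∃ H : CubeFamily.HomotopyRelBoundary ψ.top ψ'.top, ∀ s : I, ∃ θ : Distributor T (n + 1),
      θ.IsGood ∧ θ.IsBasedOn φ ∧ θ.top = H.toFun s := by
  have hex : ∀ A B : T, ∃ h : C((A ⟶ B) × ((Fin (n + 1) → I) × I), power A (n + 1 + 1) ⟶ B),
      (∀ (a : A ⟶ B) (t : Fin (n + 1) → I) (s : I), s = 0 ∨ t ∈ Cube.boundary (Fin (n + 1)) →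
        h (a, (t, s)) = ψ.universalCube A B (a, t)) ∧
      (∀ (a : A ⟶ B) (t : Fin (n + 1) → I), h (a, (t, 1)) = ψ'.universalCube A B (a, t)) ∧
      ∀ (a : A ⟶ B) (t : (Fin (n + 1) → I) × I) (k : Fin (n + 1 + 1)),
        axis A k ≫ h (a, t) = a := by
    intro A B
    let e := cylHomeomorph (Fin (n + 1))
    have he := preimage_cylBoundary (Fin (n + 1))
    -- The upper map is `ψ` at `s = 0` and on `∂I^{n+1} × I`, and `ψ'` at `s = 1`.
    obtain ⟨g, hg, hg0, hg1⟩ := exists_continuousOn_union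
      (A := {y : (A ⟶ B) × (Fin (n + 1) ⊕ Unit → I) | e y.2 ∈ openBox (Fin (n + 1))})
      (B := {y | (e y.2).2 = 1}) (isClosed_openBox.preimage (by fun_prop))
      (isClosed_eq (by fun_prop) continuous_const)
      (f := fun y => ψ.universalCube A B (y.1, (e y.2).1))
      (g := fun y => ψ'.universalCube A B (y.1, (e y.2).1)) (by fun_prop) (by fun_prop) (by
        rintro ⟨a, t⟩ (h0 | ht) (h1 : (e t).2 = 1)
        · exact absurd (h0.symm.trans h1) zero_ne_one
        · exact hψφ.top_eq_top hψφ' a _ ht)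
    obtain ⟨h, hh, hax⟩ := (hasCubeLifting_axesRestriction hT A B (n + 1 + 1)).exists_family_lift
      (F := ⟨fun y _ => y.1, by fun_prop⟩) (g := g) (hcof A B) (by
        rw [← he]; exact hg) (by
        rw [← he]
        rintro a t (ht | ht)
        · rw [hg0 (show (a, t) ∈ {y | e y.2 ∈ openBox (Fin (n + 1))} from ht)]
          exact funext fun k => hψ.axis_comp_universalCube a _ k
        · rw [hg1 (show (a, t) ∈ {y : (A ⟶ B) × (Fin (n + 1) ⊕ Unit → I) | (e y.2).2 = 1} from ht)]
          exact funext fun k => hψ'.axis_comp_universalCube a _ k)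
    rw [← he] at hh
    refine ⟨⟨fun y => h (y.1, e.symm y.2), by fun_prop⟩, fun a t s hs => ?_, fun a t => ?_,
      fun a t k => congrFun (hax _) k⟩
    · have hs' : e (e.symm (t, s)) ∈ openBox (Fin (n + 1)) := by
        rw [e.apply_symm_apply]; exact hs
      refine (hh a (e.symm (t, s)) (Or.inl hs')).trans ((hg0 hs').trans ?_)
      change ψ.universalCube A B (a, (e (e.symm (t, s))).1) = _
      rw [e.apply_symm_apply]
    · have hs' : (e (e.symm (t, 1))).2 = 1 := by rw [e.apply_symm_apply]
      refine (hh a (e.symm (t, 1)) (Or.inr hs')).trans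
        ((hg1 (show (a, e.symm (t, 1)) ∈
          {y : (A ⟶ B) × (Fin (n + 1) ⊕ Unit → I) | (e y.2).2 = 1} from hs')).trans ?_)
      change ψ'.universalCube A B (a, (e (e.symm (t, 1))).1) = _
      rw [e.apply_symm_apply]
  choose h hh0 hh1 hax using hex
  let hs : ∀ (_ : I) (A B : T), C((A ⟶ B) × (Fin (n + 1) → I), power A (n + 1 + 1) ⟶ B) :=
    fun s A B => ⟨fun y => h A B (y.1, (y.2, s)), by fun_prop⟩
  let H : CubeFamily.HomotopyRelBoundary ψ.top ψ'.top :=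
    { toFun := fun s => naturalFamily (hs s)
      map_zero := by
        funext X A B a x
        ext t
        rw [hψ.universality]
        exact congrArg (Pi.lift x ≫ ·) (hh0 A B a t 0 (Or.inl rfl))
      map_one := by
        funext X A B a x
        ext t
        rw [hψ'.universality]
        exact congrArg (Pi.lift x ≫ ·) (hh1 A B a t)
      rel_boundary := fun s X A B a x t ht => by
        rw [hψ.universality]
        exact congrArg (Pi.lift x ≫ ·) (hh0 A B a t s (Or.inr ht))
      continuous_toFun := fun X A B K f => by
        refine ContinuousMap.continuous_of_continuous_uncurry _ ?_
        exact continuous_comp_of_compact (K := K × (Fin (n + 1) → I))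
          (f := fun y => Pi.lift (f y.1).2.2)
          (g := fun y => h A B ((f y.1).2.1, (y.2, (f y.1).1)))
          (continuous_lift_of_compact (by fun_prop)) (by fun_prop) }
  refine ⟨H, fun s => hφ.exists_extension (hs s) (fun A B a t j hj => ?_)
    (fun A B a t j hj => ?_) fun A B a t k => hax A B a (t, s) k⟩
  · exact (hh0 A B a t s (Or.inr ⟨j, Or.inl hj⟩)).trans (hψφ.top_eq_faceZero a _ t j hj)
  · exact (hh0 A B a t s (Or.inr ⟨j, Or.inr hj⟩)).trans (hψφ.top_eq_faceOne a _ t j hj)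

end Result

end HigherDist

theorem mainTheorem2 {T : Type u} [Category.{v} T] [HigherDist.TopStarCategory T]
    [HigherDist.LeftLinear T] [HigherDist.MappingTheory T]
    (hT : HigherDist.IsWeaklyBilinear T)
    (hcof : ∀ A B : T, HigherDist.IsSerreCofibrant (A ⟶ B))
    (n : ℕ) (φ : HigherDist.Distributor T n) (hφ : φ.IsGood) :
    (∃ ψ : HigherDist.Distributor T (n + 1), ψ.IsGood ∧ ψ.IsBasedOn φ) ∧
    ∀ ψ ψ' : HigherDist.Distributor T (n + 1),
      ψ.IsGood → ψ.IsBasedOn φ → ψ'.IsGood → ψ'.IsBasedOn φ →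
      ∃ H : HigherDist.CubeFamily.HomotopyRelBoundary ψ.top ψ'.top,
        ∀ s : unitInterval, ∃ θ : HigherDist.Distributor T (n + 1),
          θ.IsGood ∧ θ.IsBasedOn φ ∧ θ.top = H.toFun s :=
  ⟨HigherDist.exists_good_distributor hT hcof φ hφ, fun _ _ hψ hψφ hψ' hψφ' =>
    HigherDist.exists_good_homotopy hT hcof hφ hψ hψφ hψ' hψφ'⟩
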